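/- Let $q\ge 5$ be odd and $0<\epsilon\le 1/2$. Let $W$ be the typewriter channel on $\mathbb{Z}_q$: $W(y|x)=1-\epsilon$ if $y=x$, $W(y|x)=\epsilon$ if $y=x+1 \bmod q$, and $W(y|x)=0$ otherwise. All logarithms are to base 2. Let $$E(R)=\limsup_{n\to\infty}\frac1n\log\frac{1}{\mathsf P_e(\lceil 2^{nR}\rceil,n)}\in[0,\infty]$$ be its reliability function, where $\mathsf P_e(M,n)$ is the smallest average probability of error of codes with $M$ codewords of length $n$ over the memoryless channel $W$, and let $$E_{\mathrm{sp}}(R)=\sup_{\rho\ge 0}\bigl(E_0(\rho)-\rho R\bigr),\qquad E_0(\rho)=\max_P\Bigl[-\log\sum_y\Bigl(\sum_x P(x)W(y|x)^{1/(1+\rho)}\Bigr)^{1+\rho}\Bigr]$$ be its sphere-packing exponent (possibly $\infty$), where $P$ ranges over the probability distributions on $\mathbb{Z}_q$. Let $\theta(C_q)$ be the Lovász theta function of the cycle $C_q$ of length $q$. Then there is exactly one rate $R_1>\log\theta(C_q)$ with $E_{\mathrm{sp}}(R_1)<\infty$ such that the line $\ell$ through $(\log\theta(C_q),\log\frac1\epsilon)$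 and $(R_1,E_{\mathrm{sp}}(R_1))$ is tangent to the sphere-packing curve at $R_1$, in the sense that $\ell(R)\le E_{\mathrm{sp}}(R)$ for all real $R$. If $\epsilon<1/2$, then moreover $E_{\mathrm{sp}}$ is differentiable at $R_1$ and its derivative there is the slope of $\ell$. The segment of $\ell$ between these two points is an upper bound on the reliability function: $$E(R)\le \ell(R)\qquad\text{for } \log\theta(C_q)<R\le R_1 .$$ -/

import Mathlib

open Filter

noncomputable section

/-! ### Discrete memoryless channels and the reliability function -/

/-- The typewriter channel on `ZMod q`: `typewriter q ε x y` is the probability `W(y|x)`. -/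
def typewriter (q : ℕ) (ε : ℝ) (x y : ZMod q) : ℝ :=
  if y = x then 1 - ε else if y = x + 1 then ε else 0

section Channel

variable {X Y : Type*} [Fintype X] [Fintype Y]

/-- Average error probability, over the memoryless channel `W`, of the block code of length `n`
with codewords `enc m`, `m : Fin M`, and decoder `dec`. -/
def avgErrorProb (W : X → Y → ℝ) {M n : ℕ} (enc : Fin M → Fin n → X)
    (dec : (Fin n → Y) → Fin M) : ℝ :=
  (1 / (M : ℝ)) * ∑ m : Fin M, ∑ y : Fin n → Y,
    if dec y = m then 0 else ∏ i : Fin n, W (enc m i) (y i)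

/-- The smallest average error probability of codes with `M` codewords of length `n`. -/
def minErrorProb (W : X → Y → ℝ) (M n : ℕ) : ℝ :=
  ⨅ c : (Fin M → Fin n → X) × ((Fin n → Y) → Fin M), avgErrorProb W c.1 c.2

/-- The reliability function (in bits), with values in `[-∞, ∞]`; the exponent is `∞` at
blocklengths where the error probability is `0`. -/
def reliability (W : X → Y → ℝ) (R : ℝ) : EReal :=
  limsup (fun n : ℕ =>
    if minErrorProb W ⌈(2 : ℝ) ^ ((n : ℝ) * R)⌉₊ n = 0 then (⊤ : EReal)
    else (((1 / (n : ℝ)) *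
      Real.logb 2 (1 / minErrorProb W ⌈(2 : ℝ) ^ ((n : ℝ) * R)⌉₊ n) : ℝ) : EReal)) atTop

/-- Gallager's function `E₀(ρ)`, maximized over the input distributions `P`. -/
def gallagerE0 (W : X → Y → ℝ) (ρ : ℝ) : ℝ :=
  ⨆ P : stdSimplex ℝ X,
    -Real.logb 2 (∑ y : Y, (∑ x : X, P.1 x * W x y ^ (1 / (1 + ρ))) ^ (1 + ρ))

/-- The sphere-packing exponent `E_sp(R) = sup_{ρ ≥ 0} (E₀(ρ) - ρ R)`, possibly `∞`. -/
def spherePacking (W : X → Y → ℝ) (R : ℝ) : EReal :=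
  ⨆ ρ : {ρ : ℝ // 0 ≤ ρ}, ((gallagerE0 W ρ.1 - ρ.1 * R : ℝ) : EReal)

end Channel

/-! ### The Lovász theta function -/

/-- The Lovász theta function: the infimum of `max_i 1 / ⟪c, u i⟫ ^ 2` over the orthonormal
representations `u` of `G` (unit vectors, orthogonal for distinct nonadjacent vertices) and
the unit vectors `c`. -/
def lovaszTheta {V : Type*} (G : SimpleGraph V) : ℝ :=
  sInf {t : ℝ | ∃ (d : ℕ) (u : V → EuclideanSpace ℝ (Fin d)) (c : EuclideanSpace ℝ (Fin d)),
    (∀ i, ‖u i‖ = 1) ∧ (∀ i j, i ≠ j → ¬ G.Adj i j → inner ℝ (u i) (u j) = 0) ∧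
    ‖c‖ = 1 ∧ ∀ i, inner ℝ c (u i) ≠ 0 ∧ 1 / (inner ℝ c (u i)) ^ 2 ≤ t}

/-! ### Tangent segments -/

/-- Slope of the line through `(R₀, E₀)` and `(R₁, E₁)`. -/
def slopeThrough (R₀ E₀ R₁ E₁ : ℝ) : ℝ := (E₁ - E₀) / (R₁ - R₀)

/-- Height at `R` of the line through `(R₀, E₀)` and `(R₁, E₁)`. -/
def lineThrough (R₀ E₀ R₁ E₁ R : ℝ) : ℝ := E₀ + slopeThrough R₀ E₀ R₁ E₁ * (R - R₀)

/-- The segment from `(R₀, E₀)` rightwards to the point of the curve `E = F R` at `R₁` is tangent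
to that (convex) curve: the line through it touches the curve at `R₁` and nowhere lies above
it. -/
def IsTangentAt (F : ℝ → EReal) (R₀ E₀ R₁ : ℝ) : Prop :=
  R₀ < R₁ ∧ F R₁ ≠ ⊤ ∧ F R₁ ≠ ⊥ ∧
    ∀ R : ℝ, ((lineThrough R₀ E₀ R₁ (F R₁).toReal R : ℝ) : EReal) ≤ F R

end

/-!
Two words that are confusable over `W` share an output of probability at least `ε ^ n₂`, where `n₂`
is their length, so at most `θ ^ n₂` messages, where `θ = θ(C_q)`, can be told apart by their last
`n₂` letters with a smaller probability of error. On its first `n₁` letters a code is therefore no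
better than a list decoder with lists of size `θ ^ n₂`, and counting the outputs in which a fraction
`δ` of the letters has been shifted bounds its exponent there by sphere packing. The two exponents
add up: with `n₂ ≈ t (n₁ + n₂)` the pair `(rate, exponent)` is
`t (log θ, log 1/ε) + (1 - t) (C δ, D(δ ‖ ε))`, where `C δ` is the capacity at noise level `δ`.

By Gibbs' variational principle `E₀(ρ)` is the minimum over `δ` of `ρ C δ + D(δ ‖ ε)`, attained at a
tilted noise level `δ_ρ`. Hence `ρ ↦ C δ_ρ` is a supergradient of `E₀`, the line of slope `-ρ`
touches the sphere-packing curve at `(C δ_ρ, D(δ_ρ ‖ ε))`, and the tangent through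
`(log θ, log 1/ε)` belongs to the solution of `E₀(ρ) = log 1/ε + ρ log θ`. A solution exists since
`θ < q / 2` while `log (q / 2) ≤ C δ` for all `δ`.
-/

section LovaszTheta

variable {V : Type*} {G : SimpleGraph V} {t : ℝ} {N : ℕ}

/-- The tensor product of finitely many vectors, as a vector whose coordinates are indexed by
words. -/
noncomputable def tensorVec {ι : Type*} [Fintype ι] (v : Fin N → EuclideanSpace ℝ ι) :
    EuclideanSpace ℝ (Fin N → ι) :=
  WithLp.toLp 2 fun α => ∏ i, v i (α i)

theorem inner_tensorVec {ι : Type*} [Fintype ι] (v w : Fin N → EuclideanSpace ℝ ι) :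
    inner ℝ (tensorVec v) (tensorVec w) = ∏ i, inner ℝ (v i) (w i) := by
  classical
  simp only [tensorVec, PiLp.inner_apply]
  rw [Finset.prod_univ_sum, Fintype.piFinset_univ]
  simp [Finset.prod_mul_distrib]

theorem norm_tensorVec {ι : Type*} [Fintype ι] (v : Fin N → EuclideanSpace ℝ ι) :
    ‖tensorVec v‖ = ∏ i, ‖v i‖ := by
  rw [← sq_eq_sq₀ (norm_nonneg _) (by positivity), ← real_inner_self_eq_norm_sq, inner_tensorVec,
    ← Finset.prod_pow]
  simp only [real_inner_self_eq_norm_sq]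

theorem card_mul_le_one_of_orthonormal {E ι : Type*} [NormedAddCommGroup E]
    [InnerProductSpace ℝ E] [Fintype ι] {v : ι → E} (hv : Orthonormal ℝ v) {c : E} (hc : ‖c‖ = 1)
    {s : ℝ} (hs : ∀ a, s ≤ inner ℝ (v a) c ^ 2) : Fintype.card ι * s ≤ 1 := by
  calc (Fintype.card ι * s : ℝ) = ∑ _a : ι, s := by simp
    _ ≤ ∑ a, ‖inner ℝ (v a) c‖ ^ 2 :=
        Finset.sum_le_sum fun a _ => by simpa only [Real.norm_eq_abs, sq_abs] using hs a
    _ ≤ ‖c‖ ^ 2 := hv.sum_inner_products_le c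
    _ = 1 := by rw [hc, one_pow]

/-- The set of values of the orthonormal representations of `G`; its infimum is
`lovaszTheta G`. -/
def orthonormalRepValues (G : SimpleGraph V) : Set ℝ :=
  {t : ℝ | ∃ (d : ℕ) (u : V → EuclideanSpace ℝ (Fin d)) (c : EuclideanSpace ℝ (Fin d)),
    (∀ i, ‖u i‖ = 1) ∧ (∀ i j, i ≠ j → ¬ G.Adj i j → inner ℝ (u i) (u j) = 0) ∧
    ‖c‖ = 1 ∧ ∀ i, inner ℝ c (u i) ≠ 0 ∧ 1 / (inner ℝ c (u i)) ^ 2 ≤ t}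

theorem one_le_of_mem_orthonormalRepValues [Nonempty V] (ht : t ∈ orthonormalRepValues G) :
    1 ≤ t := by
  obtain ⟨d, u, c, hu, -, hc, hval⟩ := ht
  obtain ⟨i⟩ := ‹Nonempty V›
  have hle : |inner ℝ c (u i)| ≤ 1 := by
    simpa only [hc, hu, one_mul] using abs_real_inner_le_norm c (u i)
  have hpos : 0 < inner ℝ c (u i) ^ 2 := sq_pos_of_ne_zero (hval i).1
  calc 1 ≤ 1 / inner ℝ c (u i) ^ 2 := (one_le_div hpos).2 ((sq_le_one_iff_abs_le_one _).2 hle)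
    _ ≤ t := (hval i).2

theorem bddBelow_orthonormalRepValues [Nonempty V] (G : SimpleGraph V) :
    BddBelow (orthonormalRepValues G) :=
  ⟨1, fun _ => one_le_of_mem_orthonormalRepValues⟩

theorem lovaszTheta_le_of_mem [Nonempty V] (ht : t ∈ orthonormalRepValues G) :
    lovaszTheta G ≤ t :=
  csInf_le (bddBelow_orthonormalRepValues G) ht

theorem card_le_pow_of_mem_orthonormalRepValues [Nonempty V] (ht : t ∈ orthonormalRepValues G)
    {ι : Type*} {S : Finset ι} {f : ι → Fin N → V}
    (hf : (S : Set ι).Pairwise fun a b => ∃ i, f a i ≠ f b i ∧ ¬ G.Adj (f a i) (f b i)) :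
    (S.card : ℝ) ≤ t ^ N := by
  have ht0 : 0 < t := one_pos.trans_le (one_le_of_mem_orthonormalRepValues ht)
  obtain ⟨d, u, c, hu, hG, hc, hval⟩ := ht
  have horth : Orthonormal ℝ fun a : S => tensorVec fun i => u (f a i) := by
    refine ⟨fun a => by simp [norm_tensorVec, hu], fun a b hab => ?_⟩
    obtain ⟨i, hne, hadj⟩ := hf a.2 b.2 (Subtype.coe_injective.ne hab)
    simpa only [inner_tensorVec] using Finset.prod_eq_zero (Finset.mem_univ i) (hG _ _ hne hadj)
  have hinner : ∀ a : S,
      (t ^ N)⁻¹ ≤ inner ℝ (tensorVec fun i => u (f a i)) (tensorVec fun _ => c) ^ 2 := by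
    intro a
    rw [inner_tensorVec, ← Finset.prod_pow, ← inv_pow]
    calc t⁻¹ ^ N = ∏ _i : Fin N, t⁻¹ := by simp
      _ ≤ ∏ i, inner ℝ (u (f a i)) c ^ 2 := by
        refine Finset.prod_le_prod (fun _ _ => by positivity) fun i _ => ?_
        obtain ⟨hne, hle⟩ := hval (f a i)
        rwa [real_inner_comm, inv_le_comm₀ ht0 (sq_pos_of_ne_zero hne), ← one_div]
  have hcard := card_mul_le_one_of_orthonormal horth (by simp [norm_tensorVec, hc]) hinner
  rwa [Fintype.card_coe, ← div_eq_mul_inv, div_le_one (by positivity)] at hcard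

theorem exists_gram_of_posSemidef {ι : Type*} [Fintype ι] {A : Matrix ι ι ℝ}
    (hA : A.PosSemidef) :
    ∃ u : ι → EuclideanSpace ℝ (Fin (Fintype.card ι)), Matrix.gram ℝ u = A := by
  classical
  open scoped MatrixOrder in
  obtain ⟨B, rfl⟩ := CStarAlgebra.nonneg_iff_eq_star_mul_self.mp hA.nonneg
  refine ⟨fun i => WithLp.toLp 2 fun k => B ((Fintype.equivFin ι).symm k) i, ?_⟩
  ext i j
  simp only [Matrix.gram_apply, PiLp.inner_apply, Matrix.star_eq_conjTranspose, Matrix.mul_apply,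
    Matrix.conjTranspose_apply]
  rw [← Equiv.sum_comp (Fintype.equivFin ι).symm]
  exact Finset.sum_congr rfl fun k _ => by simp [mul_comm]

-- The handle is the normalized sum of the vectors of a Gram representation of `K`.
theorem card_div_mem_orthonormalRepValues [Fintype V] [Nonempty V] {K : Matrix V V ℝ}
    (hK : K.PosSemidef) (hdiag : ∀ i, K i i = 1)
    (hzero : ∀ i j, i ≠ j → ¬ G.Adj i j → K i j = 0) {s : ℝ} (hs : 0 < s)
    (hsum : ∀ i, ∑ j, K i j = s) : Fintype.card V / s ∈ orthonormalRepValues G := by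
  obtain ⟨u, rfl⟩ := exists_gram_of_posSemidef hK
  simp only [Matrix.gram_apply] at hdiag hzero hsum
  set v := ∑ j, u j with hv
  have hinner : ∀ i, inner ℝ v (u i) = s := fun i => by
    rw [real_inner_comm, hv, inner_sum, hsum]
  have hnorm : ‖v‖ ^ 2 = Fintype.card V * s := by
    rw [← real_inner_self_eq_norm_sq]
    nth_rewrite 2 [hv]
    simp [inner_sum, hinner]
  have hv0 : 0 < ‖v‖ :=
    lt_of_pow_lt_pow_left₀ 2 (norm_nonneg v) (by rw [hnorm, zero_pow two_ne_zero]; positivity)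
  refine ⟨_, u, ‖v‖⁻¹ • v, fun i => ?_, hzero, ?_, fun i => ?_⟩
  · rw [norm_eq_sqrt_real_inner, hdiag, Real.sqrt_one]
  · rw [norm_smul, norm_inv, norm_norm, inv_mul_cancel₀ hv0.ne']
  · rw [real_inner_smul_left, hinner]
    refine ⟨by positivity, le_of_eq ?_⟩
    rw [mul_pow, inv_pow, hnorm]
    field_simp

theorem nonempty_orthonormalRepValues [Finite V] [Nonempty V] (G : SimpleGraph V) :
    (orthonormalRepValues G).Nonempty := by
  classical
  have := Fintype.ofFinite V
  exact ⟨_, card_div_mem_orthonormalRepValues (K := 1) Matrix.PosSemidef.one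
    (fun _ => Matrix.one_apply_eq _) (fun _ _ hij _ => Matrix.one_apply_ne hij) one_pos
    (fun i => by simp [Matrix.one_apply])⟩

theorem one_le_lovaszTheta [Finite V] [Nonempty V] (G : SimpleGraph V) : 1 ≤ lovaszTheta G :=
  le_csInf (nonempty_orthonormalRepValues G) fun _ => one_le_of_mem_orthonormalRepValues

theorem card_le_lovaszTheta_pow [Finite V] [Nonempty V] {ι : Type*} {S : Finset ι}
    {f : ι → Fin N → V}
    (hf : (S : Set ι).Pairwise fun a b => ∃ i, f a i ≠ f b i ∧ ¬ G.Adj (f a i) (f b i)) :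
    (S.card : ℝ) ≤ lovaszTheta G ^ N := by
  have hmem : lovaszTheta G ∈ closure (orthonormalRepValues G) :=
    csInf_mem_closure (nonempty_orthonormalRepValues G) (bddBelow_orthonormalRepValues G)
  have hclosed : IsClosed {t : ℝ | (S.card : ℝ) ≤ t ^ N} :=
    isClosed_le continuous_const (continuous_pow N)
  exact closure_minimal (fun t ht => card_le_pow_of_mem_orthonormalRepValues ht hf) hclosed hmem

theorem lovaszTheta_le_of_posSemidef_one_add_smul_adjMatrix [Fintype V] [Nonempty V]
    [DecidableEq V] [DecidableRel G.Adj] {k : ℕ} (hG : G.IsRegularOfDegree k) {y : ℝ} (hy : 0 ≤ y)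
    (hK : (1 + y • G.adjMatrix ℝ).PosSemidef) :
    lovaszTheta G ≤ Fintype.card V / (1 + y * k) := by
  refine lovaszTheta_le_of_mem (card_div_mem_orthonormalRepValues hK (fun i => ?_)
    (fun i j hij hadj => ?_) (by positivity) fun i => ?_)
  · simp
  · simp [hij, hadj]
  · have hrow := SimpleGraph.adjMatrix_mulVec_const_apply_of_regular (α := ℝ) (a := 1) hG (v := i)
    simp only [Matrix.mulVec, dotProduct, Function.const_apply, mul_one] at hrow
    simp only [Matrix.add_apply, Matrix.smul_apply, smul_eq_mul, Finset.sum_add_distrib,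
      ← Finset.mul_sum, hrow, Matrix.one_apply, Finset.sum_ite_eq, Finset.mem_univ, if_true]

end LovaszTheta

section OddCycle

variable {q : ℕ} {R : Type*} [CommRing R]

/-- The cycle of length `q` with vertex set `ZMod q`, the confusability graph of the typewriter
channel. -/
abbrev zmodCycle (q : ℕ) : SimpleGraph (ZMod q) :=
  SimpleGraph.circulantGraph {1}

theorem alternating_sum_add_succ (hq : Odd q) (x : ZMod q → R) (i : ZMod q) :
    ∑ j ∈ Finset.range q, (-1 : R) ^ j * (x (i + j) + x (i + j + 1)) = 2 * x i := by
  have htel : ∀ m : ℕ, ∑ j ∈ Finset.range m, (-1 : R) ^ j * (x (i + j) + x (i + j + 1))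
      = x i - (-1) ^ m * x (i + m) := by
    intro m
    induction m with
    | zero => simp
    | succ m ih =>
      rw [Finset.sum_range_succ, ih, Nat.cast_succ, ← add_assoc]
      ring
  rw [htel, hq.neg_one_pow, ZMod.natCast_self, add_zero]
  ring

theorem add_one_ne_sub_one (hq3 : 3 ≤ q) (i : ZMod q) : i + 1 ≠ i - 1 := by
  intro h
  have h2 : ((2 : ℕ) : ZMod q) = 0 := by push_cast; linear_combination h
  exact absurd (Nat.le_of_dvd two_pos ((ZMod.natCast_eq_zero_iff 2 q).1 h2)) (by omega)

variable [NeZero q]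

theorem sum_range_add_natCast {A : Type*} [AddCommMonoid A] (g : ZMod q → A) (i : ZMod q) :
    ∑ j ∈ Finset.range q, g (i + j) = ∑ j, g j := by
  rw [← Equiv.sum_comp (Equiv.addLeft i) g]
  refine Finset.sum_nbij' (fun j => (j : ZMod q)) ZMod.val (by simp) (fun a _ => ?_)
    (fun a ha => ?_) (by simp) (by simp)
  · simpa using ZMod.val_lt a
  · exact ZMod.val_cast_of_lt (by simpa using ha)

-- An alternating sum around the odd cycle recovers `2 * x i` from the sums `x j + x (j + 1)`, which
-- keeps the least eigenvalue of the cycle away from `-2`.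
theorem four_mul_sum_sq_le (hq : Odd q) (x : ZMod q → ℝ) :
    4 * ∑ i, x i ^ 2 ≤ q ^ 2 * ∑ i, (x i + x (i + 1)) ^ 2 := by
  have hle : ∀ i, 4 * x i ^ 2 ≤ q * ∑ j, (x j + x (j + 1)) ^ 2 := by
    intro i
    have hCS := sq_sum_le_card_mul_sum_sq (s := Finset.range q)
      (f := fun j : ℕ => (-1 : ℝ) ^ j * (x (i + j) + x (i + j + 1)))
    rw [alternating_sum_add_succ hq] at hCS
    simp only [mul_pow, pow_right_comm (-1 : ℝ) _ 2, neg_one_sq, one_pow, one_mul,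
      Finset.card_range] at hCS
    rw [sum_range_add_natCast (fun j => (x j + x (j + 1)) ^ 2)] at hCS
    linarith
  calc 4 * ∑ i, x i ^ 2 = ∑ i, 4 * x i ^ 2 := Finset.mul_sum _ _ _
    _ ≤ ∑ _i : ZMod q, q * ∑ j, (x j + x (j + 1)) ^ 2 := Finset.sum_le_sum fun i _ => hle i
    _ = q ^ 2 * ∑ i, (x i + x (i + 1)) ^ 2 := by simp [ZMod.card]; ring

theorem sum_mul_sub_one (x : ZMod q → R) :
    ∑ i, x i * x (i - 1) = ∑ i, x i * x (i + 1) := by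
  rw [← Equiv.sum_comp (Equiv.addRight (1 : ZMod q)) fun i => x i * x (i - 1)]
  simp [mul_comm]

theorem sum_add_succ_sq (x : ZMod q → R) :
    ∑ i, (x i + x (i + 1)) ^ 2 = 2 * ∑ i, x i ^ 2 + 2 * ∑ i, x i * x (i + 1) := by
  have hshift : ∑ i, x (i + 1) ^ 2 = ∑ i, x i ^ 2 :=
    Equiv.sum_comp (Equiv.addRight (1 : ZMod q)) fun i => x i ^ 2
  simp only [add_sq, Finset.sum_add_distrib, hshift, mul_assoc, ← Finset.mul_sum]
  ring

theorem neighborFinset_zmodCycle (hq2 : 2 ≤ q) (i : ZMod q) :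
    (zmodCycle q).neighborFinset i = {i + 1, i - 1} := by
  have : Fact (1 < q) := ⟨hq2⟩
  have hone := one_ne_zero (α := ZMod q)
  ext j
  rw [SimpleGraph.mem_neighborFinset]
  simp only [SimpleGraph.circulantGraph_adj, Set.mem_singleton_iff, Finset.mem_insert,
    Finset.mem_singleton]
  grind

theorem isRegularOfDegree_zmodCycle (hq3 : 3 ≤ q) :
    (zmodCycle q).IsRegularOfDegree 2 := fun i => by
  rw [← SimpleGraph.card_neighborFinset_eq_degree,
    neighborFinset_zmodCycle (by omega), Finset.card_pair (add_one_ne_sub_one hq3 i)]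

theorem posSemidef_one_add_smul_adjMatrix_zmodCycle (hq3 : 3 ≤ q) (hq : Odd q) {y : ℝ}
    (hy : 0 ≤ y) (hy' : 2 * y * (1 - 2 / (q : ℝ) ^ 2) ≤ 1) :
    (1 + y • (zmodCycle q).adjMatrix ℝ).PosSemidef := by
  refine Matrix.PosSemidef.of_dotProduct_mulVec_nonneg ?_ fun x => ?_
  · exact Matrix.isHermitian_one.add ((SimpleGraph.isHermitian_adjMatrix ℝ _).smul (.all y))
  have hquad : star x ⬝ᵥ (1 + y • (zmodCycle q).adjMatrix ℝ).mulVec x =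
      ∑ i, x i ^ 2 + 2 * y * ∑ i, x i * x (i + 1) := by
    have hmul : ∀ i, x i * ((zmodCycle q).adjMatrix ℝ).mulVec x i =
        x i * x (i + 1) + x i * x (i - 1) := fun i => by
      rw [SimpleGraph.adjMatrix_mulVec_apply, neighborFinset_zmodCycle (by omega),
        Finset.sum_pair (add_one_ne_sub_one hq3 i), mul_add]
    rw [star_trivial, Matrix.add_mulVec, Matrix.one_mulVec, Matrix.smul_mulVec, dotProduct_add,
      dotProduct_smul]
    simp only [dotProduct, hmul, Finset.sum_add_distrib, sum_mul_sub_one, smul_eq_mul, sq]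
    ring
  have hq0 : (0 : ℝ) < q ^ 2 := by have := NeZero.pos q; positivity
  have hcycle : 4 / (q : ℝ) ^ 2 * ∑ i, x i ^ 2 ≤ 2 * ∑ i, x i ^ 2 + 2 * ∑ i, x i * x (i + 1) := by
    rw [← sum_add_succ_sq, div_mul_eq_mul_div, div_le_iff₀ hq0, mul_comm _ ((q : ℝ) ^ 2)]
    exact four_mul_sum_sq_le hq x
  have hsq : 0 ≤ ∑ i, x i ^ 2 := Finset.sum_nonneg fun i _ => sq_nonneg _
  calc (0 : ℝ) ≤ (1 - 2 * y * (1 - 2 / (q : ℝ) ^ 2)) * ∑ i, x i ^ 2 :=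
        mul_nonneg (sub_nonneg.2 hy') hsq
    _ = ∑ i, x i ^ 2 + y * (4 / (q : ℝ) ^ 2 * ∑ i, x i ^ 2 - 2 * ∑ i, x i ^ 2) := by ring
    _ ≤ ∑ i, x i ^ 2 + y * (2 * ∑ i, x i * x (i + 1)) := by gcongr; linarith
    _ = _ := by rw [hquad]; ring

theorem lovaszTheta_cycleGraph_eq_lovaszTheta_zmodCycle :
    lovaszTheta (SimpleGraph.cycleGraph q) =
      lovaszTheta (zmodCycle q) := by
  obtain ⟨n, rfl⟩ := Nat.exists_eq_succ_of_ne_zero (NeZero.ne q)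
  rw [Nat.succ_eq_add_one, SimpleGraph.cycleGraph_eq_circulantGraph]
  rfl

theorem lovaszTheta_cycleGraph_lt (hq3 : 3 ≤ q) (hq : Odd q) :
    lovaszTheta (SimpleGraph.cycleGraph q) < q / 2 := by
  have hq3' : (3 : ℝ) ≤ q := by exact_mod_cast hq3
  have hb0 : 0 < 1 - 2 / (q : ℝ) ^ 2 := by
    rw [sub_pos, div_lt_one (by positivity)]; nlinarith
  have hb1 : 1 - 2 / (q : ℝ) ^ 2 < 1 := sub_lt_self 1 (by positivity)
  set y := (2 * (1 - 2 / (q : ℝ) ^ 2))⁻¹ with hy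
  have hyb : 2 * y * (1 - 2 / (q : ℝ) ^ 2) = 1 := by
    rw [hy, mul_right_comm, mul_inv_cancel₀ (by positivity)]
  have hy0 : 0 < y := by positivity
  have hy2 : 1 < 2 * y := by nlinarith
  calc lovaszTheta (SimpleGraph.cycleGraph q) ≤ Fintype.card (ZMod q) / (1 + y * (2 : ℕ)) := by
        rw [lovaszTheta_cycleGraph_eq_lovaszTheta_zmodCycle]
        exact lovaszTheta_le_of_posSemidef_one_add_smul_adjMatrix
          (isRegularOfDegree_zmodCycle hq3) hy0.le
          (posSemidef_one_add_smul_adjMatrix_zmodCycle hq3 hq hy0.le hyb.le)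
    _ < q / 2 := by
        rw [ZMod.card, Nat.cast_two]
        gcongr
        linarith

end OddCycle

section CodeBounds

variable {X Y ι : Type*} {W : X → Y → ℝ} {G : SimpleGraph X} {ε : ℝ} {M n n₁ n₂ : ℕ}

/-- The probability that the memoryless channel `W` turns the input word `x` into the output
word `y`. -/
def wordProb (W : X → Y → ℝ) (x : Fin n → X) (y : Fin n → Y) : ℝ :=
  ∏ i, W (x i) (y i)

theorem wordProb_nonneg (hW : ∀ x y, 0 ≤ W x y) (x : Fin n → X) (y : Fin n → Y) :
    0 ≤ wordProb W x y :=
  Finset.prod_nonneg fun _ _ => hW _ _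

theorem pow_le_wordProb {c : ℝ} (hc : 0 ≤ c) {x : Fin n → X} {y : Fin n → Y}
    (h : ∀ i, c ≤ W (x i) (y i)) : c ^ n ≤ wordProb W x y := by
  simpa [wordProb] using Finset.prod_le_prod (s := Finset.univ) (fun _ _ => hc) fun i _ => h i

theorem wordProb_append (x : Fin (n₁ + n₂) → X) (y : Fin n₁ → Y) (z : Fin n₂ → Y) :
    wordProb W x (Fin.append y z) =
      wordProb W (fun i => x (i.castAdd n₂)) y * wordProb W (fun i => x (i.natAdd n₁)) z := by
  simp only [wordProb, Fin.prod_univ_add, Fin.append_left, Fin.append_right]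

/-- Any two letters that are equal or adjacent in `G` have a common output whose probability is
at least `ε` given either of them. -/
def HasCommonOutputs (W : X → Y → ℝ) (G : SimpleGraph X) (ε : ℝ) : Prop :=
  ∀ x x', (x ≠ x' → G.Adj x x') → ∃ y, ε ≤ W x y ∧ ε ≤ W x' y

theorem HasCommonOutputs.exists_pow_le_wordProb (hG : HasCommonOutputs W G ε) (hε : 0 ≤ ε)
    {x x' : Fin n → X} (h : ∀ i, x i ≠ x' i → G.Adj (x i) (x' i)) :
    ∃ y, ε ^ n ≤ wordProb W x y ∧ ε ^ n ≤ wordProb W x' y := by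
  choose y hy hy' using fun i => hG (x i) (x' i) (h i)
  exact ⟨y, pow_le_wordProb hε hy, pow_le_wordProb hε hy'⟩

variable [Fintype Y] [DecidableEq ι]

/-- The probability that the decoder `dec` does not return the message `m` when the word `x` is
sent over the memoryless channel `W`. -/
def condErrorProb (W : X → Y → ℝ) (x : Fin n → X) (dec : (Fin n → Y) → ι) (m : ι) : ℝ :=
  ∑ y, if dec y = m then 0 else wordProb W x y

theorem avgErrorProb_eq_sum_condErrorProb (W : X → Y → ℝ) (enc : Fin M → Fin n → X)
    (dec : (Fin n → Y) → Fin M) :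
    avgErrorProb W enc dec = (∑ m, condErrorProb W (enc m) dec m) / M :=
  one_div_mul_eq_div _ _

theorem condErrorProb_nonneg (hW : ∀ x y, 0 ≤ W x y) (x : Fin n → X) (dec : (Fin n → Y) → ι)
    (m : ι) : 0 ≤ condErrorProb W x dec m :=
  Finset.sum_nonneg fun y _ => ite_nonneg le_rfl (wordProb_nonneg hW x y)

theorem wordProb_le_condErrorProb (hW : ∀ x y, 0 ≤ W x y) (x : Fin n → X) {y : Fin n → Y}
    {dec : (Fin n → Y) → ι} {m : ι} (hy : dec y ≠ m) :
    wordProb W x y ≤ condErrorProb W x dec m := by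
  have h := Finset.single_le_sum (f := fun y => if dec y = m then 0 else wordProb W x y)
    (fun y _ => ite_nonneg le_rfl (wordProb_nonneg hW x y)) (Finset.mem_univ y)
  simpa only [condErrorProb, if_neg hy] using h

theorem condErrorProb_append (x : Fin (n₁ + n₂) → X) (dec : (Fin (n₁ + n₂) → Y) → ι) (m : ι) :
    condErrorProb W x dec m = ∑ y, wordProb W (fun i => x (i.castAdd n₂)) y *
      condErrorProb W (fun i => x (i.natAdd n₁)) (fun z => dec (Fin.append y z)) m := by
  simp only [condErrorProb, Finset.mul_sum, mul_ite, mul_zero, ← wordProb_append]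
  rw [← Equiv.sum_comp (Fin.appendEquiv n₁ n₂), Fintype.sum_prod_type]
  rfl

-- Two confusable words share an output of probability at least `ε ^ n`, and it is decoded
-- wrongly for one of them.
theorem card_condErrorProb_lt_le [Finite X] [Nonempty X] [Fintype ι] (hW : ∀ x y, 0 ≤ W x y)
    (hε : 0 ≤ ε) (hG : HasCommonOutputs W G ε) (enc : ι → Fin n → X) (dec : (Fin n → Y) → ι) :
    ({m | condErrorProb W (enc m) dec m < ε ^ n} : Finset ι).card ≤ lovaszTheta G ^ n := by
  refine card_le_lovaszTheta_pow (f := enc) fun m hm m' hm' hne => ?_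
  by_contra! hconf
  obtain ⟨y, hy, hy'⟩ := hG.exists_pow_le_wordProb hε hconf
  have hdec : ∀ m ∈ ({m | condErrorProb W (enc m) dec m < ε ^ n} : Finset ι),
      ε ^ n ≤ wordProb W (enc m) y → dec y = m := fun m hm hmy => by
    by_contra hym
    exact ((hmy.trans (wordProb_le_condErrorProb hW _ hym)).trans_lt
      (Finset.mem_filter.1 hm).2).false
  exact hne ((hdec m hm hy).symm.trans (hdec m' hm' hy'))

theorem mul_card_sub_card_le_sum_mul {α : Type*} [Fintype α] {p e : α → ℝ} (hp : ∀ y, 0 ≤ p y)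
    (he : ∀ y, 0 ≤ e y) {A : Finset α} {u c : ℝ} (hu : 0 ≤ u) (hA : ∀ y ∈ A, u ≤ p y)
    (hc : 0 ≤ c) :
    c * (u * (A.card - ({y | e y < c} : Finset α).card)) ≤ ∑ y, p y * e y := by
  classical
  have hcard : (A.card : ℝ) - ({y | e y < c} : Finset α).card ≤
      (A.filter fun y => c ≤ e y).card := by
    have hsplit := A.card_filter_add_card_filter_not fun y => c ≤ e y
    have hle : (A.filter fun y => ¬ c ≤ e y).card ≤ ({y | e y < c} : Finset α).card :=
      Finset.card_le_card fun y hy => by simpa using (Finset.mem_filter.1 hy).2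
    rw [sub_le_iff_le_add]
    exact_mod_cast hsplit.ge.trans (by gcongr)
  calc c * (u * (A.card - ({y | e y < c} : Finset α).card))
      ≤ c * (u * (A.filter fun y => c ≤ e y).card) := by gcongr
    _ = ∑ y ∈ A with c ≤ e y, u * c := by rw [Finset.sum_const, nsmul_eq_mul]; ring
    _ ≤ ∑ y ∈ A with c ≤ e y, p y * e y := Finset.sum_le_sum fun y hy => by
        obtain ⟨hyA, hye⟩ := Finset.mem_filter.1 hy
        exact mul_le_mul (hA y hyA) hye hc (hp y)
    _ ≤ ∑ y, p y * e y := Finset.sum_le_sum_of_subset_of_nonneg (Finset.subset_univ _)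
        fun y _ _ => mul_nonneg (hp y) (he y)

variable [Finite X] [Nonempty X]

theorem sum_card_condErrorProb_lt_le (hW : ∀ x y, 0 ≤ W x y) (hε : 0 ≤ ε)
    (hG : HasCommonOutputs W G ε) [Fintype ι] (enc : ι → Fin n₂ → X)
    (dec : (Fin (n₁ + n₂) → Y) → ι) :
    ∑ m, (({y | condErrorProb W (enc m) (fun z => dec (Fin.append y z)) m < ε ^ n₂} :
      Finset (Fin n₁ → Y)).card : ℝ) ≤ Fintype.card Y ^ n₁ * lovaszTheta G ^ n₂ := by
  calc _ = ∑ y : Fin n₁ → Y, (({m | condErrorProb W (enc m) (fun z => dec (Fin.append y z)) m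
        < ε ^ n₂} : Finset ι).card : ℝ) := by
        simp only [Finset.card_filter, Nat.cast_sum]
        exact Finset.sum_comm
    _ ≤ ∑ _y : Fin n₁ → Y, lovaszTheta G ^ n₂ := Finset.sum_le_sum fun y _ =>
        card_condErrorProb_lt_le hW hε hG enc fun z => dec (Fin.append y z)
    _ = Fintype.card Y ^ n₁ * lovaszTheta G ^ n₂ := by simp

-- On its first `n₁` letters the code acts as a list decoder with lists of size
-- `lovaszTheta G ^ n₂`: a message off the list is confused on the last `n₂` letters with
-- probability at least `ε ^ n₂`.
theorem le_avgErrorProb (hW : ∀ x y, 0 ≤ W x y) (hε : 0 ≤ ε) (hG : HasCommonOutputs W G ε)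
    (hM : 0 < M) {a u : ℝ} (hu : 0 ≤ u)
    (hA : ∀ x : Fin n₁ → X, ∃ A : Finset (Fin n₁ → Y), a ≤ A.card ∧ ∀ y ∈ A, u ≤ wordProb W x y)
    (enc : Fin M → Fin (n₁ + n₂) → X) (dec : (Fin (n₁ + n₂) → Y) → Fin M) :
    ε ^ n₂ * (u * (a - lovaszTheta G ^ n₂ * Fintype.card Y ^ n₁ / M)) ≤
      avgErrorProb W enc dec := by
  have hM' : (0 : ℝ) < M := by exact_mod_cast hM
  set badOutputs : Fin M → Finset (Fin n₁ → Y) := fun m =>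
    {y | condErrorProb W (fun i => enc m (i.natAdd n₁)) (fun z => dec (Fin.append y z)) m < ε ^ n₂}
  have hmsg : ∀ m, ε ^ n₂ * (u * (a - (badOutputs m).card)) ≤ condErrorProb W (enc m) dec m := by
    intro m
    obtain ⟨A, haA, hAu⟩ := hA fun i => enc m (i.castAdd n₂)
    rw [condErrorProb_append]
    refine le_trans ?_ (mul_card_sub_card_le_sum_mul (wordProb_nonneg hW _)
      (fun y => condErrorProb_nonneg hW _ _ _) hu hAu (pow_nonneg hε n₂))
    gcongr
  have hbad : ∑ m, ((badOutputs m).card : ℝ) ≤ Fintype.card Y ^ n₁ * lovaszTheta G ^ n₂ :=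
    sum_card_condErrorProb_lt_le hW hε hG (fun m i => enc m (i.natAdd n₁)) dec
  rw [avgErrorProb_eq_sum_condErrorProb, le_div_iff₀ hM']
  calc ε ^ n₂ * (u * (a - lovaszTheta G ^ n₂ * Fintype.card Y ^ n₁ / M)) * M
      = ε ^ n₂ * (u * (M * a - Fintype.card Y ^ n₁ * lovaszTheta G ^ n₂)) := by field_simp
    _ ≤ ε ^ n₂ * (u * (M * a - ∑ m, ((badOutputs m).card : ℝ))) := by gcongr
    _ = ∑ m, ε ^ n₂ * (u * (a - (badOutputs m).card)) := by
        simp [← Finset.mul_sum, Finset.sum_sub_distrib]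
    _ ≤ ∑ m, condErrorProb W (enc m) dec m := Finset.sum_le_sum fun m _ => hmsg m

theorem le_minErrorProb (hW : ∀ x y, 0 ≤ W x y) (hε : 0 ≤ ε) (hG : HasCommonOutputs W G ε)
    (hM : 0 < M) {a u : ℝ} (hu : 0 ≤ u)
    (hA : ∀ x : Fin n₁ → X, ∃ A : Finset (Fin n₁ → Y), a ≤ A.card ∧ ∀ y ∈ A, u ≤ wordProb W x y) :
    ε ^ n₂ * (u * (a - lovaszTheta G ^ n₂ * Fintype.card Y ^ n₁ / M)) ≤
      minErrorProb W M (n₁ + n₂) := by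
  have : Nonempty (Fin M) := ⟨⟨0, hM⟩⟩
  exact le_ciInf fun c => le_avgErrorProb hW hε hG hM hu hA c.1 c.2

end CodeBounds

section Gallager

variable {X Y : Type*} [Fintype X] [Fintype Y] {W : X → Y → ℝ} {ρ r : ℝ}

theorem mul_logb_sum_le (hρ : 0 ≤ ρ) {f : Y → ℝ} (hf : ∀ y, 0 ≤ f y) (hsum : 0 < ∑ y, f y) :
    (1 + ρ) * Real.logb 2 (∑ y, f y) ≤
      ρ * Real.logb 2 (Fintype.card Y) + Real.logb 2 (∑ y, f y ^ (1 + ρ)) := by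
  have hY : Nonempty Y := by
    by_contra! hY
    simp at hsum
  have hY0 : (0 : ℝ) < Fintype.card Y := by exact_mod_cast Fintype.card_pos
  have hpow := Real.rpow_sum_le_const_mul_sum_rpow_of_nonneg Finset.univ
    (le_add_of_nonneg_right hρ : 1 ≤ 1 + ρ) fun y _ => hf y
  rw [Finset.card_univ, add_sub_cancel_left] at hpow
  have hpos : 0 < ∑ y, f y ^ (1 + ρ) :=
    pos_of_mul_pos_right ((Real.rpow_pos_of_pos hsum _).trans_le hpow) (by positivity)
  rw [← Real.logb_rpow_eq_mul_logb_of_pos hsum, ← Real.logb_rpow_eq_mul_logb_of_pos hY0,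
    ← Real.logb_mul (by positivity) hpos.ne']
  exact Real.logb_le_logb_of_le one_lt_two (by positivity) hpow

theorem gallagerE0_eq_of_symmetric [Nonempty X] (hW : ∀ x y, 0 ≤ W x y) (hρ : 0 ≤ ρ) (hr : 0 < r)
    (hrow : ∀ x, ∑ y, W x y ^ (1 / (1 + ρ)) = r)
    (hcol : ∀ y, ∑ x, W x y ^ (1 / (1 + ρ)) = Fintype.card X * (r / Fintype.card Y)) :
    gallagerE0 W ρ = ρ * Real.logb 2 (Fintype.card Y) - (1 + ρ) * Real.logb 2 r := by
  have hX0 : (0 : ℝ) < Fintype.card X := by exact_mod_cast Fintype.card_pos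
  have hY : Nonempty Y := by
    by_contra! hY
    obtain ⟨x⟩ := ‹Nonempty X›
    exact hr.ne (by simpa using hrow x)
  have hY0 : (0 : ℝ) < Fintype.card Y := by exact_mod_cast Fintype.card_pos
  have hle : ∀ P : stdSimplex ℝ X,
      -Real.logb 2 (∑ y, (∑ x, P.1 x * W x y ^ (1 / (1 + ρ))) ^ (1 + ρ)) ≤
        ρ * Real.logb 2 (Fintype.card Y) - (1 + ρ) * Real.logb 2 r := by
    intro P
    have hsum : ∑ y, ∑ x, P.1 x * W x y ^ (1 / (1 + ρ)) = r := by
      rw [Finset.sum_comm]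
      simp only [← Finset.mul_sum, hrow, ← Finset.sum_mul, P.2.2, one_mul]
    have hlog := mul_logb_sum_le hρ (f := fun y => ∑ x, P.1 x * W x y ^ (1 / (1 + ρ)))
      (fun y => Finset.sum_nonneg fun x _ => mul_nonneg (P.2.1 x) (Real.rpow_nonneg (hW x y) _))
      (hsum ▸ hr)
    rw [hsum] at hlog
    linarith
  let unif : stdSimplex ℝ X := ⟨fun _ => 1 / Fintype.card X, fun _ => by positivity, by simp⟩
  have : Nonempty (stdSimplex ℝ X) := ⟨unif⟩
  refine le_antisymm (ciSup_le hle) (le_ciSup_of_le ⟨_, Set.forall_mem_range.2 hle⟩ unif ?_)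
  have hunif : ∀ y, ∑ x, unif.1 x * W x y ^ (1 / (1 + ρ)) = r / Fintype.card Y := fun y => by
    rw [← Finset.mul_sum, hcol, one_div, inv_mul_cancel_left₀ hX0.ne']
  simp only [hunif, Finset.sum_const, Finset.card_univ, nsmul_eq_mul]
  rw [Real.logb_mul hY0.ne' (by positivity), Real.logb_rpow_eq_mul_logb_of_pos (by positivity),
    Real.logb_div hr.ne' hY0.ne']
  linarith

end Gallager

section Typewriter

variable {q : ℕ} {ε : ℝ} {n : ℕ}

theorem typewriter_nonneg (hε0 : 0 ≤ ε) (hε1 : ε ≤ 1) (x y : ZMod q) :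
    0 ≤ typewriter q ε x y := by
  unfold typewriter
  split_ifs <;> linarith

theorem hasCommonOutputs_typewriter (q : ℕ) (hε : ε ≤ 1 / 2) :
    HasCommonOutputs (typewriter q ε) (zmodCycle q) ε := by
  have hself : ∀ x : ZMod q, ε ≤ typewriter q ε x x := fun x => by
    rw [typewriter, if_pos rfl]; linarith
  have hsucc : ∀ x : ZMod q, ε ≤ typewriter q ε x (x + 1) := fun x => by
    unfold typewriter
    rw [if_pos (rfl : x + 1 = x + 1)]
    split_ifs <;> linarith
  intro x x' h
  by_cases hxx' : x = x'
  · exact ⟨x, hself x, hxx' ▸ hself x⟩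
  · have hadj := h hxx'
    rw [SimpleGraph.circulantGraph_adj] at hadj
    obtain ⟨-, hsub | hsub⟩ := hadj
    · obtain rfl : x = x' + 1 := sub_eq_iff_eq_add'.mp hsub
      exact ⟨_, hself _, hsucc _⟩
    · obtain rfl : x' = x + 1 := sub_eq_iff_eq_add'.mp hsub
      exact ⟨_, hsucc _, hself _⟩

variable [Nontrivial (ZMod q)]

theorem wordProb_typewriter_piecewise (x : Fin n → ZMod q) (s : Finset (Fin n)) :
    wordProb (typewriter q ε) x (s.piecewise (x + 1) x) =
      ε ^ s.card * (1 - ε) ^ (n - s.card) := by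
  have hletter : ∀ i, typewriter q ε (x i) (s.piecewise (x + 1) x i) =
      if i ∈ s then ε else 1 - ε := fun i => by
    by_cases hi : i ∈ s <;> simp [typewriter, hi]
  simp [wordProb, hletter, Finset.prod_ite, Finset.filter_not, Finset.card_sdiff]

theorem piecewise_add_one_injective (x : Fin n → ZMod q) :
    Function.Injective fun s : Finset (Fin n) => s.piecewise (x + 1) x := by
  intro s t hst
  ext i
  have hi := congrFun hst i
  by_cases hs : i ∈ s <;> by_cases ht : i ∈ t <;> simp_all

theorem exists_card_eq_choose_wordProb_typewriter (x : Fin n → ZMod q) (k : ℕ) :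
    ∃ A : Finset (Fin n → ZMod q), A.card = n.choose k ∧
      ∀ y ∈ A, wordProb (typewriter q ε) x y = ε ^ k * (1 - ε) ^ (n - k) := by
  refine ⟨(Finset.powersetCard k .univ).map ⟨_, piecewise_add_one_injective x⟩, by simp, ?_⟩
  simp only [Finset.mem_map, Finset.mem_powersetCard_univ, forall_exists_index, and_imp,
    Function.Embedding.coeFn_mk]
  rintro y s rfl rfl
  exact wordProb_typewriter_piecewise x s

theorem typewriter_rpow {s : ℝ} (hs : s ≠ 0) (x y : ZMod q) :
    typewriter q ε x y ^ s =
      (if y = x then (1 - ε) ^ s else 0) + if y = x + 1 then ε ^ s else 0 := by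
  unfold typewriter
  by_cases h : y = x
  · simp [h]
  · split_ifs <;> simp [Real.zero_rpow hs]

variable [NeZero q]

theorem sum_output_typewriter_rpow {s : ℝ} (hs : s ≠ 0) (x : ZMod q) :
    ∑ y, typewriter q ε x y ^ s = ε ^ s + (1 - ε) ^ s := by
  simp [typewriter_rpow hs, Finset.sum_add_distrib, add_comm]

theorem sum_input_typewriter_rpow {s : ℝ} (hs : s ≠ 0) (y : ZMod q) :
    ∑ x, typewriter q ε x y ^ s = ε ^ s + (1 - ε) ^ s := by
  simp [typewriter_rpow hs, Finset.sum_add_distrib, add_comm, ← sub_eq_iff_eq_add]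

theorem gallagerE0_typewriter (hε0 : 0 < ε) (hε1 : ε < 1) {ρ : ℝ} (hρ : 0 ≤ ρ) :
    gallagerE0 (typewriter q ε) ρ = ρ * Real.logb 2 q -
      (1 + ρ) * Real.logb 2 (ε ^ (1 / (1 + ρ)) + (1 - ε) ^ (1 / (1 + ρ))) := by
  have hs : 1 / (1 + ρ) ≠ 0 := by positivity
  have : 0 < 1 - ε := sub_pos.2 hε1
  have hq : (Fintype.card (ZMod q) : ℝ) ≠ 0 := by simp [NeZero.ne q]
  rw [gallagerE0_eq_of_symmetric (typewriter_nonneg hε0.le hε1.le) hρ (by positivity)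
    (sum_output_typewriter_rpow hs) fun y => ?_, ZMod.card]
  rw [sum_input_typewriter_rpow hs, mul_div_cancel₀ _ hq]

end Typewriter

section Conjugate

open scoped Topology

/-- The conjugate `R ↦ sup_{ρ ≥ 0} (E ρ - ρ R)` of a function on `[0, ∞)`; the sphere-packing
exponent is by definition the conjugate of Gallager's function. -/
noncomputable def conjugate (E : ℝ → ℝ) (R : ℝ) : EReal :=
  ⨆ ρ : {ρ : ℝ // 0 ≤ ρ}, ((E ρ.1 - ρ.1 * R : ℝ) : EReal)

/-- `r` is a continuous choice of supergradients of `E` on `[0, ∞)`. In particular `E` is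
concave there; on the conjugate curve, `ρ` parametrizes the point with abscissa `r ρ` at which
`-ρ` is the slope of a tangent. -/
structure HasContinuousSupergradient (E r : ℝ → ℝ) : Prop where
  le : ∀ ρ, 0 ≤ ρ → ∀ ρ', 0 ≤ ρ' → E ρ' ≤ E ρ + (ρ' - ρ) * r ρ
  continuousOn : ContinuousOn r (Set.Ici 0)

variable {E r : ℝ → ℝ} {R₀ e₀ ρ : ℝ}

theorem le_conjugate (E : ℝ → ℝ) (hρ : 0 ≤ ρ) (R : ℝ) :
    ((E ρ - ρ * R : ℝ) : EReal) ≤ conjugate E R :=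
  le_iSup (fun ρ : {ρ : ℝ // 0 ≤ ρ} => ((E ρ.1 - ρ.1 * R : ℝ) : EReal)) ⟨ρ, hρ⟩

theorem conjugate_le_coe {R c : ℝ} (h : ∀ ρ, 0 ≤ ρ → E ρ - ρ * R ≤ c) :
    conjugate E R ≤ (c : EReal) :=
  iSup_le fun ρ => EReal.coe_le_coe (h ρ.1 ρ.2)

/-- The intercept `ρ ↦ E ρ - ρ R₀` at `R₀` of the line of slope `-ρ` vanishes at `0` and grows at
least linearly. -/
theorem exists_eq_add_mul (hE : ContinuousOn E (Set.Ici 0)) (hE0 : E 0 = 0) (he₀ : 0 < e₀) {c : ℝ}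
    (hc : R₀ < c) (hgrow : ∀ ρ, 0 ≤ ρ → ρ * c ≤ E ρ) : ∃ ρ, 0 < ρ ∧ E ρ = e₀ + ρ * R₀ := by
  have hc' : 0 < c - R₀ := sub_pos.mpr hc
  have hb : 0 ≤ e₀ / (c - R₀) := by positivity
  have hcont : ContinuousOn (fun ρ => E ρ - ρ * R₀) (Set.Icc 0 (e₀ / (c - R₀))) :=
    (hE.mono Set.Icc_subset_Ici_self).sub (by fun_prop)
  have hright : e₀ ≤ E (e₀ / (c - R₀)) - e₀ / (c - R₀) * R₀ := by
    linarith [hgrow _ hb, div_mul_cancel₀ e₀ hc'.ne']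
  obtain ⟨ρ, hρ, hρe⟩ := intermediate_value_Icc hb hcont ⟨by simp [hE0, he₀.le], hright⟩
  have hρe' : E ρ = e₀ + ρ * R₀ := sub_eq_iff_eq_add.mp hρe
  refine ⟨ρ, hρ.1.lt_of_ne ?_, hρe'⟩
  rintro rfl
  linarith

namespace HasContinuousSupergradient

theorem conjugate_eq (h : HasContinuousSupergradient E r) (hρ : 0 ≤ ρ) :
    conjugate E (r ρ) = ((E ρ - ρ * r ρ : ℝ) : EReal) :=
  le_antisymm (conjugate_le_coe fun ρ' hρ' => by linarith [h.le ρ hρ ρ' hρ'])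
    (le_conjugate E hρ _)

theorem continuousOn_fun (h : HasContinuousSupergradient E r) : ContinuousOn E (Set.Ici 0) := by
  intro ρ hρ
  have hr := h.continuousOn ρ hρ
  have hid : Tendsto (fun ρ' => ρ' - ρ) (𝓝[Set.Ici 0] ρ) (𝓝 0) :=
    tendsto_nhdsWithin_of_tendsto_nhds (Continuous.tendsto' (by fun_prop) _ _ (sub_self ρ))
  refine tendsto_of_tendsto_of_tendsto_of_le_of_le' (g := fun ρ' => E ρ + (ρ' - ρ) * r ρ')
    (h := fun ρ' => E ρ + (ρ' - ρ) * r ρ) ?_ ?_ ?_ ?_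
  · simpa using (hid.mul hr).const_add (E ρ)
  · simpa using (hid.mul_const (r ρ)).const_add (E ρ)
  · filter_upwards [self_mem_nhdsWithin] with ρ' hρ'
    linarith [h.le ρ' hρ' ρ hρ]
  · filter_upwards [self_mem_nhdsWithin] with ρ' hρ' using h.le ρ hρ ρ' hρ'

theorem eq_of_forall_le (h : HasContinuousSupergradient E r) (hρ : 0 < ρ) {s : ℝ}
    (hs : ∀ ρ', 0 ≤ ρ' → E ρ' ≤ E ρ + (ρ' - ρ) * s) : s = r ρ := by
  have hcont : Tendsto r (𝓝 ρ) (𝓝 (r ρ)) := h.continuousOn.continuousAt (Ici_mem_nhds hρ)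
  have hmono : ∀ ρ', 0 ≤ ρ' → (ρ' - ρ) * r ρ' ≤ (ρ' - ρ) * s := fun ρ' hρ' => by
    linarith [hs ρ' hρ', h.le ρ' hρ' ρ hρ.le]
  apply le_antisymm
  · refine ge_of_tendsto (hcont.mono_left (nhdsWithin_le_nhds (s := Set.Iio ρ))) ?_
    filter_upwards [Ioo_mem_nhdsLT hρ] with ρ' hρ'
    exact (mul_le_mul_left_of_neg (sub_neg.mpr hρ'.2)).mp (hmono ρ' hρ'.1.le)
  · refine le_of_tendsto (hcont.mono_left (nhdsWithin_le_nhds (s := Set.Ioi ρ))) ?_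
    filter_upwards [self_mem_nhdsWithin] with ρ' (hρ' : ρ < ρ')
    exact (mul_le_mul_iff_right₀ (sub_pos.mpr hρ')).mp (hmono ρ' (hρ.trans hρ').le)

theorem strictMonoOn_sub_mul (h : HasContinuousSupergradient E r)
    (hR₀ : ∀ ρ, 0 ≤ ρ → R₀ < r ρ) : StrictMonoOn (fun ρ => E ρ - ρ * R₀) (Set.Ici 0) := by
  intro ρ hρ ρ' hρ' hlt
  have hpos := mul_pos (sub_pos.mpr hlt) (sub_pos.mpr (hR₀ ρ' hρ'))
  have hsuper := h.le ρ' hρ' ρ hρ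
  dsimp only
  linarith

theorem slopeThrough_eq (h : HasContinuousSupergradient E r) (hρ : 0 ≤ ρ)
    (hρe : E ρ = e₀ + ρ * R₀) (hR : R₀ < r ρ) :
    slopeThrough R₀ e₀ (r ρ) (conjugate E (r ρ)).toReal = -ρ := by
  rw [h.conjugate_eq hρ, EReal.toReal_coe, slopeThrough, div_eq_iff (sub_pos.mpr hR).ne', hρe]
  ring

theorem isTangentAt (h : HasContinuousSupergradient E r) (hρ : 0 ≤ ρ)
    (hρe : E ρ = e₀ + ρ * R₀) (hR : R₀ < r ρ) : IsTangentAt (conjugate E) R₀ e₀ (r ρ) := by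
  refine ⟨hR, ?_, ?_, fun R => ?_⟩
  · exact h.conjugate_eq hρ ▸ EReal.coe_ne_top _
  · exact h.conjugate_eq hρ ▸ EReal.coe_ne_bot _
  rw [lineThrough, h.slopeThrough_eq hρ hρe hR]
  convert le_conjugate E hρ R using 2
  rw [hρe]
  ring

/-- A line of slope `-ρ ≥ 0` that is positive at `R₀` would exceed the conjugate far to the right,
where the conjugate is at most `E 0 = 0`. -/
theorem pos_of_forall_line_le (h : HasContinuousSupergradient E r) (hE0 : E 0 = 0) (he₀ : 0 < e₀)
    (hline : ∀ R : ℝ, ((e₀ + ρ * (R₀ - R) : ℝ) : EReal) ≤ conjugate E R) : 0 < ρ := by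
  by_contra! hρ
  have hR₀ : R₀ ≤ max (r 0) R₀ := le_max_right _ _
  have hr0 : r 0 ≤ max (r 0) R₀ := le_max_left _ _
  have hle : conjugate E (max (r 0) R₀) ≤ ((0 : ℝ) : EReal) := conjugate_le_coe fun ρ' hρ' => by
    linarith [h.le 0 le_rfl ρ' hρ', mul_le_mul_of_nonneg_left hr0 hρ']
  have hval := EReal.coe_le_coe_iff.mp ((hline (max (r 0) R₀)).trans hle)
  linarith [mul_nonneg_of_nonpos_of_nonpos hρ (sub_nonpos.mpr hR₀)]

theorem exists_eq_of_isTangentAt (h : HasContinuousSupergradient E r) (hE0 : E 0 = 0)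
    (he₀ : 0 < e₀) {R₁ : ℝ} (hT : IsTangentAt (conjugate E) R₀ e₀ R₁) :
    ∃ ρ, 0 < ρ ∧ E ρ = e₀ + ρ * R₀ ∧ R₁ = r ρ := by
  obtain ⟨hR, htop, hbot, hline⟩ := hT
  lift conjugate E R₁ to ℝ using ⟨htop, hbot⟩ with c hc
  obtain ⟨ρ, hslope⟩ : ∃ ρ, slopeThrough R₀ e₀ R₁ c = -ρ := ⟨_, (neg_neg _).symm⟩
  have hc_eq : c = e₀ + ρ * (R₀ - R₁) := by
    rw [slopeThrough, div_eq_iff (sub_pos.mpr hR).ne'] at hslope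
    linarith
  have hline' : ∀ R : ℝ, ((e₀ + ρ * (R₀ - R) : ℝ) : EReal) ≤ conjugate E R := fun R => by
    convert hline R using 2
    rw [EReal.toReal_coe, lineThrough, hslope]
    ring
  have hρ : 0 < ρ := h.pos_of_forall_line_le hE0 he₀ hline'
  have hupper : ∀ ρ', 0 ≤ ρ' → E ρ' - ρ' * R₁ ≤ c := fun ρ' hρ' =>
    EReal.coe_le_coe_iff.mp (hc ▸ le_conjugate E hρ' R₁)
  have hlower : e₀ + ρ * (R₀ - r ρ) ≤ E ρ - ρ * r ρ :=
    EReal.coe_le_coe_iff.mp (h.conjugate_eq hρ.le ▸ hline' (r ρ))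
  have hρe : E ρ = e₀ + ρ * R₀ := by linarith [hupper ρ hρ.le]
  exact ⟨ρ, hρ, hρe, h.eq_of_forall_le hρ fun ρ' hρ' => by linarith [hupper ρ' hρ']⟩

theorem exists_isTangentAt_iff (h : HasContinuousSupergradient E r) (hE0 : E 0 = 0) (he₀ : 0 < e₀)
    {c : ℝ} (hc : R₀ < c) (hr : ∀ ρ, 0 ≤ ρ → c ≤ r ρ) :
    ∃ ρ, 0 < ρ ∧ E ρ = e₀ + ρ * R₀ ∧ ∀ R₁, IsTangentAt (conjugate E) R₀ e₀ R₁ ↔ R₁ = r ρ := by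
  have hR₀ : ∀ ρ, 0 ≤ ρ → R₀ < r ρ := fun ρ hρ => hc.trans_le (hr ρ hρ)
  have hgrow : ∀ ρ, 0 ≤ ρ → ρ * c ≤ E ρ := fun ρ hρ => by
    linarith [h.le ρ hρ 0 le_rfl, mul_le_mul_of_nonneg_left (hr ρ hρ) hρ]
  obtain ⟨ρ, hρ, hρe⟩ := exists_eq_add_mul h.continuousOn_fun hE0 he₀ hc hgrow
  refine ⟨ρ, hρ, hρe, fun R₁ => ⟨fun hT => ?_, fun hR₁ => ?_⟩⟩
  · obtain ⟨ρ', hρ', hρe', rfl⟩ := h.exists_eq_of_isTangentAt hE0 he₀ hT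
    have heq : E ρ' - ρ' * R₀ = E ρ - ρ * R₀ := by linarith
    rw [(h.strictMonoOn_sub_mul hR₀).injOn hρ'.le hρ.le heq]
  · exact hR₁ ▸ h.isTangentAt hρ.le hρe (hR₀ ρ hρ.le)

/-- Write `R = r ρ'` with `ρ'` near `ρ`. The two supergradient inequalities confine the remainder
of the linear approximation to `[0, (ρ - ρ') (R - r ρ)]`. -/
theorem hasDerivAt_conjugate (h : HasContinuousSupergradient E r)
    (hr : StrictAntiOn r (Set.Ici 0)) (hρ : 0 < ρ) :
    HasDerivAt (fun R => (conjugate E R).toReal) (-ρ) (r ρ) := by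
  rw [hasDerivAt_iff_isLittleO, Asymptotics.isLittleO_iff]
  intro η hη
  obtain ⟨κ, hκ0, hκη, hκρ⟩ : ∃ κ, 0 < κ ∧ κ ≤ η ∧ κ ≤ ρ :=
    ⟨min η ρ, lt_min hη hρ, min_le_left _ _, min_le_right _ _⟩
  have hleft : 0 ≤ ρ - κ := sub_nonneg.mpr hκρ
  have hnhds : Set.Ioo (r (ρ + κ)) (r (ρ - κ)) ∈ 𝓝 (r ρ) :=
    Ioo_mem_nhds (hr hρ.le (add_pos hρ hκ0).le (by linarith)) (hr hleft hρ.le (by linarith))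
  filter_upwards [hnhds] with R hR
  obtain ⟨ρ', hρ', rfl⟩ := intermediate_value_Icc' (by linarith : ρ - κ ≤ ρ + κ)
    (h.continuousOn.mono fun x hx => hleft.trans hx.1) (Set.Ioo_subset_Icc_self hR)
  have hρ'0 : 0 ≤ ρ' := hleft.trans hρ'.1
  have hdist : |ρ - ρ'| ≤ η := by
    rw [abs_le]
    constructor <;> linarith [hρ'.1, hρ'.2]
  have hsuper := h.le ρ hρ.le ρ' hρ'0
  have hsuper' := h.le ρ' hρ'0 ρ hρ.le
  simp only [h.conjugate_eq hρ.le, h.conjugate_eq hρ'0, EReal.toReal_coe, smul_eq_mul,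
    Real.norm_eq_abs]
  rw [abs_of_nonneg (by linarith)]
  calc E ρ' - ρ' * r ρ' - (E ρ - ρ * r ρ) - (r ρ' - r ρ) * -ρ
      ≤ (ρ - ρ') * (r ρ' - r ρ) := by linarith
    _ ≤ |ρ - ρ'| * |r ρ' - r ρ| := (le_abs_self _).trans_eq (abs_mul _ _)
    _ ≤ η * |r ρ' - r ρ| := by gcongr

end HasContinuousSupergradient

end Conjugate

section Tilting

/-- Relative entropy, in bits, of the Bernoulli distributions with parameters `δ` and `ε`. -/
noncomputable def binKLDiv (δ ε : ℝ) : ℝ :=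
  δ * Real.logb 2 (δ / ε) + (1 - δ) * Real.logb 2 ((1 - δ) / (1 - ε))

/-- The capacity, in bits, of the typewriter channel with noise level `δ`. -/
noncomputable def typewriterCapacity (q : ℕ) (δ : ℝ) : ℝ :=
  Real.logb 2 q - Real.binEntropy δ / Real.log 2

/-- The Bernoulli parameter proportional to `ε ^ (1 / (1 + ρ))`: the noise level that dominates
the errors at the point of the sphere-packing curve with slope `-ρ`. -/
noncomputable def tilt (ε ρ : ℝ) : ℝ :=
  ε ^ (1 / (1 + ρ)) / (ε ^ (1 / (1 + ρ)) + (1 - ε) ^ (1 / (1 + ρ)))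

variable {q : ℕ} {ε δ ρ : ℝ}

theorem binKLDiv_eq (hδ0 : 0 < δ) (hδ1 : δ < 1) (hε0 : 0 < ε) (hε1 : ε < 1) :
    binKLDiv δ ε = -(δ * Real.logb 2 ε + (1 - δ) * Real.logb 2 (1 - ε)) -
      Real.binEntropy δ / Real.log 2 := by
  rw [binKLDiv, Real.logb_div hδ0.ne' hε0.ne',
    Real.logb_div (sub_pos.mpr hδ1).ne' (sub_pos.mpr hε1).ne', Real.binEntropy,
    Real.log_inv, Real.log_inv]
  unfold Real.logb
  ring

theorem logb_half_le_typewriterCapacity [NeZero q] (δ : ℝ) :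
    Real.logb 2 (q / 2) ≤ typewriterCapacity q δ := by
  have hbit : Real.binEntropy δ / Real.log 2 ≤ 1 :=
    (div_le_one (Real.log_pos one_lt_two)).mpr Real.binEntropy_le_log_two
  rw [Real.logb_div (NeZero.ne (q : ℝ)) two_ne_zero, Real.logb_self_eq_one one_lt_two,
    typewriterCapacity]
  linarith

theorem tilt_mem_Ioo (hε0 : 0 < ε) (hε1 : ε < 1) (ρ : ℝ) : tilt ε ρ ∈ Set.Ioo 0 1 := by
  have : 0 < 1 - ε := sub_pos.mpr hε1
  unfold tilt
  exact ⟨by positivity, (div_lt_one (by positivity)).mpr (lt_add_of_pos_right _ (by positivity))⟩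

theorem tilt_le_half (hε0 : 0 < ε) (hε : ε ≤ 1 / 2) (hρ : 0 ≤ ρ) : tilt ε ρ ≤ 2⁻¹ := by
  have hε1 : 0 < 1 - ε := by linarith
  have hpow : ε ^ (1 / (1 + ρ)) ≤ (1 - ε) ^ (1 / (1 + ρ)) :=
    Real.rpow_le_rpow hε0.le (by linarith) (by positivity)
  rw [tilt, div_le_iff₀ (by positivity)]
  linarith

theorem continuousOn_tilt (hε0 : 0 < ε) (hε1 : ε < 1) : ContinuousOn (tilt ε) (Set.Ici 0) := by
  have hε1' : 0 < 1 - ε := sub_pos.mpr hε1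
  have hexp : ContinuousOn (fun ρ : ℝ => 1 / (1 + ρ)) (Set.Ici 0) :=
    continuousOn_const.div (by fun_prop) fun ρ (hρ : 0 ≤ ρ) => by positivity
  have hpow : ∀ {a : ℝ}, 0 < a → ContinuousOn (fun ρ : ℝ => a ^ (1 / (1 + ρ))) (Set.Ici 0) :=
    fun ha => continuousOn_const.rpow hexp fun _ _ => Or.inl ha.ne'
  exact (hpow hε0).div ((hpow hε0).add (hpow hε1')) fun ρ _ => by positivity

theorem strictMonoOn_tilt (hε0 : 0 < ε) (hε : ε < 1 / 2) :
    StrictMonoOn (tilt ε) (Set.Ici 0) := by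
  intro ρ hρ ρ' hρ' hlt
  rw [Set.mem_Ici] at hρ hρ'
  have hε1 : 0 < 1 - ε := by linarith
  have hexp : 1 / (1 + ρ') < 1 / (1 + ρ) := by gcongr
  have hratio : (ε / (1 - ε)) ^ (1 / (1 + ρ)) < (ε / (1 - ε)) ^ (1 / (1 + ρ')) :=
    Real.rpow_lt_rpow_of_exponent_gt (by positivity) (by rw [div_lt_one hε1]; linarith) hexp
  rw [Real.div_rpow hε0.le hε1.le, Real.div_rpow hε0.le hε1.le,
    div_lt_div_iff₀ (by positivity) (by positivity)] at hratio
  rw [tilt, tilt, div_lt_div_iff₀ (by positivity) (by positivity)]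
  linarith

theorem strictAntiOn_typewriterCapacity_tilt (q : ℕ) (hε0 : 0 < ε) (hε : ε < 1 / 2) :
    StrictAntiOn (fun ρ => typewriterCapacity q (tilt ε ρ)) (Set.Ici 0) := by
  intro ρ hρ ρ' hρ' hlt
  have hmem : ∀ ρ, 0 ≤ ρ → tilt ε ρ ∈ Set.Icc 0 2⁻¹ := fun ρ hρ =>
    ⟨(tilt_mem_Ioo hε0 (by linarith) ρ).1.le, tilt_le_half hε0 hε.le hρ⟩
  have hentropy := Real.binEntropy_strictMonoOn (hmem ρ hρ) (hmem ρ' hρ')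
    (strictMonoOn_tilt hε0 hε hρ hρ' hlt)
  exact sub_lt_sub_left (div_lt_div_of_pos_right hentropy (Real.log_pos one_lt_two)) _

theorem binEntropy_add_le_log {a b : ℝ} (hδ0 : 0 < δ) (hδ1 : δ < 1) (ha : 0 < a) (hb : 0 < b) :
    Real.binEntropy δ + (δ * Real.log a + (1 - δ) * Real.log b) ≤ Real.log (a + b) := by
  have hδ1' : 0 < 1 - δ := sub_pos.mpr hδ1
  have hjensen := strictConcaveOn_log_Ioi.concaveOn.2 (div_pos ha hδ0) (div_pos hb hδ1') hδ0.le
    hδ1'.le (add_sub_cancel _ _)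
  rw [smul_eq_mul, smul_eq_mul, smul_eq_mul, smul_eq_mul, mul_div_cancel₀ _ hδ0.ne',
    mul_div_cancel₀ _ hδ1'.ne', Real.log_div ha.ne' hδ0.ne', Real.log_div hb.ne' hδ1'.ne']
    at hjensen
  rw [Real.binEntropy, Real.log_inv, Real.log_inv]
  linarith

theorem binEntropy_add_eq_log {a b : ℝ} (ha : 0 < a) (hb : 0 < b) :
    Real.binEntropy (a / (a + b)) + (a / (a + b) * Real.log a + (1 - a / (a + b)) * Real.log b) =
      Real.log (a + b) := by
  have hab : 0 < a + b := add_pos ha hb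
  have hcompl : 1 - a / (a + b) = b / (a + b) := by field_simp; ring
  rw [Real.binEntropy, hcompl, Real.log_inv, Real.log_inv, Real.log_div ha.ne' hab.ne',
    Real.log_div hb.ne' hab.ne']
  field_simp
  ring

theorem mul_typewriterCapacity_add_binKLDiv (q : ℕ) (hδ0 : 0 < δ) (hδ1 : δ < 1) (hε0 : 0 < ε)
    (hε1 : ε < 1) (hρ : 0 ≤ ρ) :
    ρ * typewriterCapacity q δ + binKLDiv δ ε = ρ * Real.logb 2 q - (1 + ρ) *
      ((Real.binEntropy δ + (δ * Real.log (ε ^ (1 / (1 + ρ))) +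
        (1 - δ) * Real.log ((1 - ε) ^ (1 / (1 + ρ))))) / Real.log 2) := by
  have hρ' : 1 + ρ ≠ 0 := by positivity
  rw [typewriterCapacity, binKLDiv_eq hδ0 hδ1 hε0 hε1, Real.log_rpow hε0,
    Real.log_rpow (sub_pos.mpr hε1)]
  unfold Real.logb
  field_simp
  ring

variable [NeZero q] [Nontrivial (ZMod q)]

theorem gallagerE0_typewriter_le (hδ0 : 0 < δ) (hδ1 : δ < 1) (hε0 : 0 < ε) (hε1 : ε < 1)
    (hρ : 0 ≤ ρ) :
    gallagerE0 (typewriter q ε) ρ ≤ ρ * typewriterCapacity q δ + binKLDiv δ ε := by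
  have : 0 < 1 - ε := sub_pos.mpr hε1
  rw [gallagerE0_typewriter hε0 hε1 hρ, mul_typewriterCapacity_add_binKLDiv q hδ0 hδ1 hε0 hε1 hρ]
  gcongr
  exact div_le_div_of_nonneg_right
    (binEntropy_add_le_log hδ0 hδ1 (by positivity) (by positivity)) (Real.log_pos one_lt_two).le

theorem gallagerE0_typewriter_eq_tilt (hε0 : 0 < ε) (hε1 : ε < 1) (hρ : 0 ≤ ρ) :
    gallagerE0 (typewriter q ε) ρ =
      ρ * typewriterCapacity q (tilt ε ρ) + binKLDiv (tilt ε ρ) ε := by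
  have : 0 < 1 - ε := sub_pos.mpr hε1
  obtain ⟨htilt0, htilt1⟩ := tilt_mem_Ioo hε0 hε1 ρ
  rw [gallagerE0_typewriter hε0 hε1 hρ,
    mul_typewriterCapacity_add_binKLDiv q htilt0 htilt1 hε0 hε1 hρ, tilt,
    binEntropy_add_eq_log (by positivity) (by positivity), Real.logb, Real.logb]

theorem gallagerE0_typewriter_zero (hε0 : 0 < ε) (hε1 : ε < 1) :
    gallagerE0 (typewriter q ε) 0 = 0 := by
  simp [gallagerE0_typewriter hε0 hε1 le_rfl]

theorem hasContinuousSupergradient_gallagerE0_typewriter (hε0 : 0 < ε) (hε1 : ε < 1) :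
    HasContinuousSupergradient (gallagerE0 (typewriter q ε))
      fun ρ => typewriterCapacity q (tilt ε ρ) where
  le ρ hρ ρ' hρ' := by
    obtain ⟨htilt0, htilt1⟩ := tilt_mem_Ioo hε0 hε1 ρ
    linarith [gallagerE0_typewriter_le (q := q) htilt0 htilt1 hε0 hε1 hρ',
      gallagerE0_typewriter_eq_tilt (q := q) hε0 hε1 hρ]
  continuousOn := continuousOn_const.sub
    ((Real.binEntropy_continuous.comp_continuousOn (continuousOn_tilt hε0 hε1)).div_const _)

end Tilting

section Asymptotics

open scoped Topology Nat

theorem tendsto_log_factorial_div_sub_log :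
    Tendsto (fun n : ℕ => Real.log n ! / n - Real.log n) atTop (𝓝 (-1)) := by
  have hlogdiv : Tendsto (fun n : ℕ => Real.log n / n) atTop (𝓝 0) :=
    Real.isLittleO_log_id_atTop.tendsto_div_nhds_zero.comp tendsto_natCast_atTop_atTop
  have hconst : ∀ c : ℝ, Tendsto (fun n : ℕ => c / n) atTop (𝓝 0) :=
    fun c => tendsto_const_div_atTop_nhds_zero_nat c
  have hstirling : Tendsto (fun n : ℕ => Real.log (Stirling.stirlingSeq n) / n) atTop (𝓝 0) :=
    ((Real.continuousAt_log (by positivity)).tendsto.comp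
      Stirling.tendsto_stirlingSeq_sqrt_pi).div_atTop tendsto_natCast_atTop_atTop
  have hlim := ((hstirling.add (hlogdiv.const_mul (1 / 2))).add
    (hconst (1 / 2 * Real.log 2))).sub_const 1
  simp only [mul_zero, add_zero, zero_sub] at hlim
  refine hlim.congr' ?_
  filter_upwards [eventually_ne_atTop 0] with n hn
  have hn' : (n : ℝ) ≠ 0 := Nat.cast_ne_zero.mpr hn
  rw [Stirling.log_stirlingSeq_formula, Real.log_mul two_ne_zero hn',
    Real.log_div hn' (Real.exp_ne_zero 1), Real.log_exp]
  field_simp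
  ring

theorem log_choose_div {n k : ℕ} (hk : 0 < k) (hkn : k < n) :
    Real.log (n.choose k) / n = Real.binEntropy (k / n) + (Real.log n ! / n - Real.log n) -
      k / n * (Real.log k ! / k - Real.log k) -
      (1 - k / n) * (Real.log (n - k)! / (n - k : ℕ) - Real.log (n - k : ℕ)) := by
  have hn0 : (n : ℝ) ≠ 0 := by norm_cast; lia
  have hk0 : (k : ℝ) ≠ 0 := by norm_cast; lia
  have hnk0 : ((n - k : ℕ) : ℝ) ≠ 0 := by norm_cast; lia
  have hcompl : 1 - (k : ℝ) / n = (n - k : ℕ) / n := by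
    rw [Nat.cast_sub hkn.le]
    field_simp
  rw [Nat.cast_choose ℝ hkn.le, Real.log_div (by positivity) (by positivity),
    Real.log_mul (by positivity) (by positivity), Real.binEntropy, hcompl, Real.log_inv,
    Real.log_inv, Real.log_div hk0 hn0, Real.log_div hnk0 hn0]
  have hsum : (n : ℝ) = k + (n - k : ℕ) := by rw [Nat.cast_sub hkn.le]; ring
  field_simp
  rw [hsum]
  ring

theorem tendsto_atTop_of_tendsto_div {k : ℕ → ℕ} {δ : ℝ} (hδ : 0 < δ)
    (hk : Tendsto (fun n => (k n : ℝ) / n) atTop (𝓝 δ)) : Tendsto k atTop atTop := by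
  rw [← tendsto_natCast_atTop_iff (R := ℝ)]
  refine (hk.pos_mul_atTop hδ tendsto_natCast_atTop_atTop).congr' ?_
  filter_upwards [eventually_ne_atTop 0] with n hn
  exact div_mul_cancel₀ _ (Nat.cast_ne_zero.mpr hn)

theorem tendsto_sub_div {k : ℕ → ℕ} {δ : ℝ} (hle : ∀ᶠ n in atTop, k n ≤ n)
    (hk : Tendsto (fun n => (k n : ℝ) / n) atTop (𝓝 δ)) :
    Tendsto (fun n => ((n - k n : ℕ) : ℝ) / n) atTop (𝓝 (1 - δ)) := by
  refine (hk.const_sub 1).congr' ?_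
  filter_upwards [hle, eventually_ne_atTop 0] with n hle hn
  rw [Nat.cast_sub hle, sub_div, div_self (Nat.cast_ne_zero.mpr hn)]

theorem tendsto_log_choose_div {k : ℕ → ℕ} {δ : ℝ} (hδ0 : 0 < δ) (hδ1 : δ < 1)
    (hk : Tendsto (fun n => (k n : ℝ) / n) atTop (𝓝 δ)) :
    Tendsto (fun n : ℕ => Real.log (n.choose (k n)) / n) atTop (𝓝 (Real.binEntropy δ)) := by
  have hpos : ∀ᶠ n : ℕ in atTop, 0 < k n ∧ k n < n := by
    filter_upwards [hk.eventually (Ioo_mem_nhds hδ0 hδ1), eventually_gt_atTop 0] with n hn hn0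
    have hn0' : (0 : ℝ) < n := Nat.cast_pos.mpr hn0
    exact ⟨Nat.cast_pos.mp ((div_pos_iff_of_pos_right hn0').mp hn.1),
      Nat.cast_lt.mp ((div_lt_one hn0').mp hn.2)⟩
  have hk_atTop : Tendsto k atTop atTop := tendsto_atTop_of_tendsto_div hδ0 hk
  have hnk_atTop : Tendsto (fun n => n - k n) atTop atTop :=
    tendsto_atTop_of_tendsto_div (sub_pos.mpr hδ1)
      (tendsto_sub_div (hpos.mono fun _ hn => hn.2.le) hk)
  have hf := tendsto_log_factorial_div_sub_log
  have hlim := (((Real.binEntropy_continuous.tendsto δ).comp hk).add hf).sub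
    (hk.mul (hf.comp hk_atTop)) |>.sub ((hk.const_sub 1).mul (hf.comp hnk_atTop))
  have hval : Real.binEntropy δ + -1 - δ * -1 - (1 - δ) * -1 = Real.binEntropy δ := by ring
  rw [hval] at hlim
  refine hlim.congr' ?_
  filter_upwards [hpos] with n hn using (log_choose_div hn.1 hn.2).symm

variable {X Y : Type*} {W : X → Y → ℝ} {G : SimpleGraph X}

/-- Over the channel `W`, every input word of length `n` has at least `a n` output words of
probability at least `u n`, where `a n` and `u n` are `2 ^ (n h + o(n))` and `2 ^ (-n c + o(n))`. -/
structure HasOutputSets (W : X → Y → ℝ) (a u : ℕ → ℝ) (h c : ℝ) : Prop where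
  card_pos : ∀ n, 0 < a n
  prob_pos : ∀ n, 0 < u n
  exists_finset : ∀ n, ∀ x : Fin n → X, ∃ A : Finset (Fin n → Y),
    a n ≤ A.card ∧ ∀ y ∈ A, u n ≤ wordProb W x y
  tendsto_card : Tendsto (fun n : ℕ => Real.logb 2 (a n) / n) atTop (𝓝 h)
  tendsto_prob : Tendsto (fun n : ℕ => -Real.logb 2 (u n) / n) atTop (𝓝 c)

theorem hasOutputSets_typewriter {q : ℕ} [Nontrivial (ZMod q)] [NeZero q] {ε δ : ℝ} (hε0 : 0 < ε)
    (hε1 : ε < 1) (hδ0 : 0 < δ) (hδ1 : δ < 1) :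
    HasOutputSets (typewriter q ε) (fun n => n.choose ⌊δ * n⌋₊)
      (fun n => ε ^ ⌊δ * n⌋₊ * (1 - ε) ^ (n - ⌊δ * n⌋₊)) (Real.binEntropy δ / Real.log 2)
      (-(δ * Real.logb 2 ε + (1 - δ) * Real.logb 2 (1 - ε))) := by
  have : 0 < 1 - ε := sub_pos.mpr hε1
  have hle : ∀ n : ℕ, ⌊δ * n⌋₊ ≤ n := fun n =>
    Nat.floor_le_of_le (mul_le_of_le_one_left n.cast_nonneg hδ1.le)
  have hk : Tendsto (fun n : ℕ => (⌊δ * n⌋₊ : ℝ) / n) atTop (𝓝 δ) :=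
    (tendsto_nat_floor_mul_div_atTop hδ0.le).comp tendsto_natCast_atTop_atTop
  refine ⟨fun n => by exact_mod_cast Nat.choose_pos (hle n), fun n => by positivity,
    fun n x => ?_, ?_, ?_⟩
  · obtain ⟨A, hcard, hA⟩ := exists_card_eq_choose_wordProb_typewriter (ε := ε) x ⌊δ * n⌋₊
    exact ⟨A, by rw [hcard], fun y hy => (hA y hy).ge⟩
  · refine ((tendsto_log_choose_div hδ0 hδ1 hk).div_const _).congr fun n => ?_
    rw [Real.logb, div_right_comm]
  · have hlim := (hk.mul_const (Real.logb 2 ε)).add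
      ((hk.const_sub 1).mul_const (Real.logb 2 (1 - ε))) |>.neg
    refine hlim.congr' ?_
    filter_upwards [eventually_ne_atTop 0] with n hn
    have hn' : (n : ℝ) ≠ 0 := Nat.cast_ne_zero.mpr hn
    rw [Real.logb_mul (by positivity) (by positivity), Real.logb_pow, Real.logb_pow,
      Nat.cast_sub (hle n)]
    field_simp

theorem reliability_le_of_tendsto [Fintype Y] {R E : ℝ} {b : ℕ → ℝ}
    (hb : ∀ᶠ n : ℕ in atTop, 0 < b n ∧ b n ≤ minErrorProb W ⌈(2 : ℝ) ^ ((n : ℝ) * R)⌉₊ n)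
    (hlim : Tendsto (fun n : ℕ => -Real.logb 2 (b n) / n) atTop (𝓝 E)) :
    reliability W R ≤ (E : EReal) := by
  rw [← ((continuous_coe_real_ereal.tendsto E).comp hlim).limsup_eq]
  refine limsup_le_limsup ?_
  filter_upwards [hb] with n ⟨hpos, hle⟩
  rw [if_neg (hpos.trans_le hle).ne', Function.comp_apply, EReal.coe_le_coe_iff, one_div,
    one_div, Real.logb_inv, inv_mul_eq_div]
  gcongr
  exact one_lt_two

namespace HasOutputSets

variable {a u : ℕ → ℝ} {h c ε μ R : ℝ}

theorem eventually_pow_mul_pow_div_le [Fintype Y] [Nonempty Y]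
    (hW : HasOutputSets W a u h c) {θ : ℝ} (hθ : 0 < θ) (hμ1 : μ < 1) {n₁ n₂ : ℕ → ℕ}
    (hn₁ : Tendsto (fun n => (n₁ n : ℝ) / n) atTop (𝓝 (1 - μ)))
    (hn₂ : Tendsto (fun n => (n₂ n : ℝ) / n) atTop (𝓝 μ))
    (hR : μ * Real.logb 2 θ + (1 - μ) * (Real.logb 2 (Fintype.card Y) - h) < R) :
    ∀ᶠ n : ℕ in atTop, θ ^ n₂ n * (Fintype.card Y : ℝ) ^ n₁ n / ⌈(2 : ℝ) ^ ((n : ℝ) * R)⌉₊ ≤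
      a (n₁ n) / 2 := by
  have : (0 : ℝ) < Fintype.card Y := Nat.cast_pos.mpr Fintype.card_pos
  have hn₁' : Tendsto n₁ atTop atTop := tendsto_atTop_of_tendsto_div (sub_pos.mpr hμ1) hn₁
  have hlim := ((hn₂.mul_const (Real.logb 2 θ)).add (hn₁.mul
    ((hW.tendsto_card.comp hn₁').const_sub (Real.logb 2 (Fintype.card Y))))).add
    (tendsto_const_div_atTop_nhds_zero_nat 1)
  rw [add_zero] at hlim
  filter_upwards [hlim.eventually_lt_const hR, eventually_gt_atTop 0,
    hn₁'.eventually_gt_atTop 0] with n hlt hn hn₁0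
  have ha := hW.card_pos (n₁ n)
  have hn' : (0 : ℝ) < n := Nat.cast_pos.mpr hn
  have : (0 : ℝ) < n₁ n := Nat.cast_pos.mpr hn₁0
  have hlog : n₂ n * Real.logb 2 θ + n₁ n * Real.logb 2 (Fintype.card Y) + 1 ≤
      Real.logb 2 (a (n₁ n)) + n * R := by
    have hmul := mul_lt_mul_of_pos_right hlt hn'
    simp only [Function.comp_apply] at hmul
    field_simp at hmul
    linarith
  have hpow : θ ^ n₂ n * (Fintype.card Y : ℝ) ^ n₁ n * 2 ≤ a (n₁ n) * 2 ^ ((n : ℝ) * R) := by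
    rw [← Real.logb_le_logb one_lt_two (by positivity) (by positivity),
      Real.logb_mul (by positivity) two_ne_zero, Real.logb_mul (by positivity) (by positivity),
      Real.logb_mul ha.ne' (by positivity), Real.logb_pow, Real.logb_pow,
      Real.logb_rpow two_pos (by norm_num), Real.logb_self_eq_one one_lt_two]
    exact hlog
  rw [div_le_div_iff₀ (Nat.cast_pos.mpr (Nat.ceil_pos.mpr (by positivity))) two_pos]
  exact hpow.trans (mul_le_mul_of_nonneg_left (Nat.le_ceil _) ha.le)

theorem tendsto_neg_logb_div (hW : HasOutputSets W a u h c) (hε : 0 < ε) (hμ1 : μ < 1)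
    {n₁ n₂ : ℕ → ℕ} (hn₁ : Tendsto (fun n => (n₁ n : ℝ) / n) atTop (𝓝 (1 - μ)))
    (hn₂ : Tendsto (fun n => (n₂ n : ℝ) / n) atTop (𝓝 μ)) :
    Tendsto (fun n : ℕ => -Real.logb 2 (ε ^ n₂ n * (u (n₁ n) * (a (n₁ n) / 2))) / n) atTop
      (𝓝 (μ * Real.logb 2 (1 / ε) + (1 - μ) * (c - h))) := by
  have hn₁' : Tendsto n₁ atTop atTop := tendsto_atTop_of_tendsto_div (sub_pos.mpr hμ1) hn₁
  have hlim := ((hn₂.mul_const (Real.logb 2 (1 / ε))).add (hn₁.mul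
    ((hW.tendsto_prob.comp hn₁').sub (hW.tendsto_card.comp hn₁')))).add
    (tendsto_const_div_atTop_nhds_zero_nat 1)
  rw [add_zero] at hlim
  refine hlim.congr' ?_
  filter_upwards [eventually_ne_atTop 0, hn₁'.eventually_ne_atTop 0] with n hn hn₁0
  have ha := hW.card_pos (n₁ n)
  have hu := hW.prob_pos (n₁ n)
  have hn' : (n : ℝ) ≠ 0 := Nat.cast_ne_zero.mpr hn
  have hn₁0' : (n₁ n : ℝ) ≠ 0 := Nat.cast_ne_zero.mpr hn₁0
  rw [Real.logb_mul (by positivity) (by positivity), Real.logb_mul hu.ne' (by positivity),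
    Real.logb_div ha.ne' two_ne_zero, Real.logb_pow, Real.logb_self_eq_one one_lt_two, one_div,
    Real.logb_inv]
  simp only [Function.comp_apply]
  field_simp
  ring

theorem reliability_le_of_lt [Finite X] [Nonempty X] [Fintype Y] [Nonempty Y]
    (hW : HasOutputSets W a u h c)
    (hW0 : ∀ x y, 0 ≤ W x y) (hG : HasCommonOutputs W G ε) (hε : 0 < ε) (hμ0 : 0 ≤ μ) (hμ1 : μ < 1)
    (hR : μ * Real.logb 2 (lovaszTheta G) +
      (1 - μ) * (Real.logb 2 (Fintype.card Y) - h) < R) :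
    reliability W R ≤ ((μ * Real.logb 2 (1 / ε) + (1 - μ) * (c - h) : ℝ) : EReal) := by
  have hθ : 0 < lovaszTheta G := one_pos.trans_le (one_le_lovaszTheta G)
  have hceil_le : ∀ n : ℕ, ⌈μ * n⌉₊ ≤ n := fun n =>
    Nat.ceil_le.mpr (mul_le_of_le_one_left n.cast_nonneg hμ1.le)
  have hn₂ : Tendsto (fun n : ℕ => (⌈μ * n⌉₊ : ℝ) / n) atTop (𝓝 μ) :=
    (tendsto_nat_ceil_mul_div_atTop hμ0).comp tendsto_natCast_atTop_atTop
  have hn₁ : Tendsto (fun n : ℕ => ((n - ⌈μ * n⌉₊ : ℕ) : ℝ) / n) atTop (𝓝 (1 - μ)) :=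
    tendsto_sub_div (.of_forall hceil_le) hn₂
  refine reliability_le_of_tendsto ?_ (hW.tendsto_neg_logb_div hε hμ1 hn₁ hn₂)
  filter_upwards [hW.eventually_pow_mul_pow_div_le hθ hμ1 hn₁ hn₂ hR] with n hlist
  have ha := hW.card_pos (n - ⌈μ * n⌉₊)
  have hu := hW.prob_pos (n - ⌈μ * n⌉₊)
  have hM : 0 < ⌈(2 : ℝ) ^ ((n : ℝ) * R)⌉₊ := Nat.ceil_pos.mpr (by positivity)
  have hPe := le_minErrorProb (n₂ := ⌈μ * n⌉₊) hW0 hε.le hG hM hu.le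
    (hW.exists_finset (n - ⌈μ * n⌉₊))
  rw [Nat.sub_add_cancel (hceil_le n)] at hPe
  refine ⟨by positivity, le_trans ?_ hPe⟩
  gcongr
  linarith

theorem reliability_le [Finite X] [Nonempty X] [Fintype Y] [Nonempty Y]
    (hW : HasOutputSets W a u h c)
    (hW0 : ∀ x y, 0 ≤ W x y) (hG : HasCommonOutputs W G ε) (hε : 0 < ε) {t : ℝ} (ht0 : 0 ≤ t)
    (ht1 : t < 1) (hcap : Real.logb 2 (lovaszTheta G) < Real.logb 2 (Fintype.card Y) - h) :
    reliability W (t * Real.logb 2 (lovaszTheta G) +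
        (1 - t) * (Real.logb 2 (Fintype.card Y) - h)) ≤
      ((t * Real.logb 2 (1 / ε) + (1 - t) * (c - h) : ℝ) : EReal) := by
  have hcont : Continuous fun μ : ℝ =>
      ((μ * Real.logb 2 (1 / ε) + (1 - μ) * (c - h) : ℝ) : EReal) :=
    continuous_coe_real_ereal.comp (by fun_prop)
  refine ge_of_tendsto ((hcont.tendsto t).mono_left (nhdsWithin_le_nhds (s := Set.Ioi t))) ?_
  filter_upwards [Ioo_mem_nhdsGT ht1] with μ hμ
  refine hW.reliability_le_of_lt hW0 hG hε (ht0.trans hμ.1.le) hμ.2 ?_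
  linarith [mul_pos (sub_pos.mpr hμ.1) (sub_pos.mpr hcap)]

end HasOutputSets

end Asymptotics

section StraightLine

variable {q : ℕ} [NeZero q]

theorem logb_lovaszTheta_cycleGraph_lt (hq3 : 3 ≤ q) (hq : Odd q) :
    Real.logb 2 (lovaszTheta (SimpleGraph.cycleGraph q)) < Real.logb 2 (q / 2) := by
  have hθ : 1 ≤ lovaszTheta (SimpleGraph.cycleGraph q) := by
    rw [lovaszTheta_cycleGraph_eq_lovaszTheta_zmodCycle]
    exact one_le_lovaszTheta _
  exact Real.logb_lt_logb one_lt_two (one_pos.trans_le hθ) (lovaszTheta_cycleGraph_lt hq3 hq)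

variable [Nontrivial (ZMod q)] {ε δ ρ : ℝ}

theorem reliability_typewriter_le (hε0 : 0 < ε) (hε : ε ≤ 1 / 2) (hδ0 : 0 < δ) (hδ1 : δ < 1)
    {t : ℝ} (ht0 : 0 ≤ t) (ht1 : t < 1)
    (hR₀ : Real.logb 2 (lovaszTheta (SimpleGraph.cycleGraph q)) < typewriterCapacity q δ) :
    reliability (typewriter q ε) (t * Real.logb 2 (lovaszTheta (SimpleGraph.cycleGraph q)) +
        (1 - t) * typewriterCapacity q δ) ≤
      ((t * Real.logb 2 (1 / ε) + (1 - t) * binKLDiv δ ε : ℝ) : EReal) := by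
  have hε1 : ε < 1 := by linarith
  have hsets := hasOutputSets_typewriter (q := q) hε0 hε1 hδ0 hδ1
  have hbound := hsets.reliability_le (t := t) (typewriter_nonneg hε0.le hε1.le)
    (hasCommonOutputs_typewriter q hε) hε0 ht0 ht1
  rw [ZMod.card, ← typewriterCapacity, ← binKLDiv_eq hδ0 hδ1 hε0 hε1,
    ← lovaszTheta_cycleGraph_eq_lovaszTheta_zmodCycle] at hbound
  exact hbound hR₀

theorem reliability_typewriter_le_line (hε0 : 0 < ε) (hε : ε ≤ 1 / 2) (hρ : 0 ≤ ρ) {R₀ R : ℝ}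
    (hR₀ : R₀ = Real.logb 2 (lovaszTheta (SimpleGraph.cycleGraph q)))
    (hρe : gallagerE0 (typewriter q ε) ρ = Real.logb 2 (1 / ε) + ρ * R₀)
    (hR₀R : R₀ < R) (hR : R ≤ typewriterCapacity q (tilt ε ρ)) :
    reliability (typewriter q ε) R ≤ ((Real.logb 2 (1 / ε) + -ρ * (R - R₀) : ℝ) : EReal) := by
  have hε1 : ε < 1 := by linarith
  obtain ⟨htilt0, htilt1⟩ := tilt_mem_Ioo hε0 hε1 ρ
  have hgap : 0 < typewriterCapacity q (tilt ε ρ) - R₀ := sub_pos.mpr (hR₀R.trans_le hR)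
  obtain ⟨t, ht⟩ : ∃ t, t * (typewriterCapacity q (tilt ε ρ) - R₀) =
      typewriterCapacity q (tilt ε ρ) - R := ⟨_, div_mul_cancel₀ _ hgap.ne'⟩
  have ht0 : 0 ≤ t := nonneg_of_mul_nonneg_left (ht ▸ sub_nonneg.mpr hR) hgap
  have ht1 : t < 1 := by
    rw [← mul_lt_iff_lt_one_left hgap]
    linarith
  have hbound := reliability_typewriter_le (q := q) hε0 hε htilt0 htilt1 ht0 ht1
    (hR₀ ▸ sub_pos.mp hgap)
  rw [← hR₀] at hbound
  convert hbound using 2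
  · linarith
  · have heq := gallagerE0_typewriter_eq_tilt (q := q) hε0 hε1 hρ
    linear_combination -ρ * ht + (1 - t) * (heq - hρe)

end StraightLine

theorem theorem5_general (q : ℕ) [NeZero q] (hq3 : 3 ≤ q) (hq : Odd q)
    (ε : ℝ) (hε0 : 0 < ε) (hε : ε ≤ 1 / 2) :
    (∃! R₁ : ℝ, IsTangentAt (spherePacking (typewriter q ε))
      (Real.logb 2 (lovaszTheta (SimpleGraph.cycleGraph q))) (Real.logb 2 (1 / ε)) R₁) ∧
    ∀ R₁ : ℝ, IsTangentAt (spherePacking (typewriter q ε))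
        (Real.logb 2 (lovaszTheta (SimpleGraph.cycleGraph q))) (Real.logb 2 (1 / ε)) R₁ →
      (ε < 1 / 2 →
        HasDerivAt (fun R : ℝ => (spherePacking (typewriter q ε) R).toReal)
          (slopeThrough (Real.logb 2 (lovaszTheta (SimpleGraph.cycleGraph q)))
            (Real.logb 2 (1 / ε)) R₁ (spherePacking (typewriter q ε) R₁).toReal) R₁) ∧
      ∀ R : ℝ, Real.logb 2 (lovaszTheta (SimpleGraph.cycleGraph q)) < R → R ≤ R₁ →
        reliability (typewriter q ε) R ≤
          ((lineThrough (Real.logb 2 (lovaszTheta (SimpleGraph.cycleGraph q)))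
            (Real.logb 2 (1 / ε)) R₁ (spherePacking (typewriter q ε) R₁).toReal R : ℝ) :
            EReal) := by
  have : Fact (1 < q) := ⟨by lia⟩
  have hε1 : ε < 1 := by linarith
  have he₀ : 0 < Real.logb 2 (1 / ε) := Real.logb_pos one_lt_two ((one_lt_div hε0).mpr hε1)
  have hgap := logb_lovaszTheta_cycleGraph_lt hq3 hq
  have hE := hasContinuousSupergradient_gallagerE0_typewriter (q := q) hε0 hε1
  have hcapacity := fun ρ => logb_half_le_typewriterCapacity (q := q) (tilt ε ρ)
  have hconjugate : spherePacking (typewriter q ε) = conjugate (gallagerE0 (typewriter q ε)) := rfl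
  obtain ⟨ρ, hρ, hρe, htangent⟩ := hE.exists_isTangentAt_iff
    (gallagerE0_typewriter_zero hε0 hε1) he₀ hgap fun ρ _ => hcapacity ρ
  have hslope := hE.slopeThrough_eq hρ.le hρe (hgap.trans_le (hcapacity ρ))
  rw [hconjugate]
  refine ⟨⟨_, (htangent _).mpr rfl, fun R₁ => (htangent R₁).mp⟩, fun R₁ hT => ?_⟩
  obtain rfl := (htangent R₁).mp hT
  refine ⟨fun hε' => ?_, fun R hR₀R hR => ?_⟩
  · rw [hslope]
    exact hE.hasDerivAt_conjugate (strictAntiOn_typewriterCapacity_tilt q hε0 hε') hρ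
  · rw [lineThrough, hslope]
    exact reliability_typewriter_le_line hε0 hε hρ.le rfl hρe hR₀R hR

theorem theorem5 (q : ℕ) [NeZero q] (hq4 : 4 ≤ q) (hq : Odd q)
    (ε : ℝ) (hε0 : 0 < ε) (hε : ε ≤ 1 / 2) :
    (∃! R₁ : ℝ, IsTangentAt (spherePacking (typewriter q ε))
      (Real.logb 2 (lovaszTheta (SimpleGraph.cycleGraph q))) (Real.logb 2 (1 / ε)) R₁) ∧
    ∀ R₁ : ℝ, IsTangentAt (spherePacking (typewriter q ε))
        (Real.logb 2 (lovaszTheta (SimpleGraph.cycleGraph q))) (Real.logb 2 (1 / ε)) R₁ →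
      (ε < 1 / 2 →
        HasDerivAt (fun R : ℝ => (spherePacking (typewriter q ε) R).toReal)
          (slopeThrough (Real.logb 2 (lovaszTheta (SimpleGraph.cycleGraph q)))
            (Real.logb 2 (1 / ε)) R₁ (spherePacking (typewriter q ε) R₁).toReal) R₁) ∧
      ∀ R : ℝ, Real.logb 2 (lovaszTheta (SimpleGraph.cycleGraph q)) < R → R ≤ R₁ →
        reliability (typewriter q ε) R ≤
          ((lineThrough (Real.logb 2 (lovaszTheta (SimpleGraph.cycleGraph q)))
            (Real.logb 2 (1 / ε)) R₁ (spherePacking (typewriter q ε) R₁).toReal R : ℝ) :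
            EReal) :=
  theorem5_general q (by lia) hq ε hε0 hε
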